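/- For $\hbar>0$ let $\mathrm{Tr}^\hbar(\cdot)=(2\pi\hbar)^3\mathrm{Tr}(\cdot)$. Let $\mathcal A_{\rm qm}$ be the set of compact self-adjoint operators $\gamma$ on $L^2(\mathbb R^3;\mathbb C)$ with $0\le\gamma\le 1$ and $\mathrm{Tr}\big((1-\Delta)^{1/4}\gamma(1-\Delta)^{1/4}\big)<\infty$. For $\gamma\in\mathcal A_{\rm qm}$ with integral kernel $\gamma(x,x')$ let $\rho^\hbar_\gamma(x)=(2\pi\hbar)^3\gamma(x,x)$ and $\Phi^\hbar_\gamma=-\frac1{|x|}*\rho^\hbar_\gamma$, and define $$K_{\rm qm}=\inf_{0\ne\gamma\in\mathcal A_{\rm qm}}\frac{\|\gamma\|^{1/3}\,\big(\mathrm{Tr}^\hbar(\gamma)\big)^{2/3}\,\mathrm{Tr}^\hbar\big(|\hbar\nabla|^{1/2}\gamma|\hbar\nabla|^{1/2}\big)}{\frac1{4\pi}\|\nabla\Phi^\hbar_\gamma\|_{L^2(\mathbb R^3)}^2},\qquad \mathbf M_{\rm qm}=(2K_{\rm qm})^{3/2},$$ where $\|\gamma\|$ is the operator norm and $|\hbar\nabla|^{1/2}$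 is the Fourier multiplier with symbol $(\hbar|\xi|)^{1/2}$ (by homogeneity the quotient does not depend on $\hbar$). Let $\mathcal A_{\rm cm}$ be the set of real-valued $f\in L^1(\mathbb R^3\times\mathbb R^3)$, $f=f(q,p)$, with $0\le f\le 1$ a.e. and $|p|f\in L^1(\mathbb R^3\times\mathbb R^3)$. For $f\in\mathcal A_{\rm cm}$ let $\rho_f(q)=\int_{\mathbb R^3}f(q,p)\,dp$ and $\Phi_f=-\frac1{|x|}*\rho_f$, and define $$K_{\rm cm}=\inf_{0\ne f\in\mathcal A_{\rm cm}}\frac{\|f\|_{L^\infty(\mathbb R^3\times\mathbb R^3)}^{1/3}\,\|f\|_{L^1(\mathbb R^3\times\mathbb R^3)}^{2/3}\,\big\||p|f\big\|_{L^1(\mathbb R^3\times\mathbb R^3)}}{\frac1{4\pi}\|\nabla\Phi_f\|_{L^2(\mathbb R^3)}^2},\qquad \mathbf M_{\rm cm}=(2K_{\rm cm})^{3/2}.$$ Then, for every $\hbar>0$, $$\mathbf M_{\rm qm}=(2K_{\rm qm})^{3/2}\ \le\ \mathbf M_{\rm cm}=(2K_{\rm cm})^{3/2}.$$ -/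

import Mathlib

open MeasureTheory
open scoped FourierTransform ENNReal ContDiff InnerProductSpace

namespace Chandrasekhar

noncomputable section

/-- Physical space `ℝ³`, with the Euclidean norm. -/
abbrev R3 : Type := EuclideanSpace ℝ (Fin 3)

/-- The one-particle Hilbert space `L²(ℝ³; ℂ)`. -/
abbrev L2R3 : Type := Lp ℂ 2 (volume : Measure R3)

/-! ### Self-generated potentials -/

/-- The gravitational potential `Φ = -|x|⁻¹ * ρ` of a mass density `ρ`. -/
def potential (ρ : R3 → ℝ) (x : R3) : ℝ := -∫ y, ρ y / ‖x - y‖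

/-- `G` is the weak (distributional) gradient of `Φ` on `ℝ³`. -/
structure IsWeakGradient (Φ : R3 → ℝ) (G : R3 → R3) : Prop where
  locallyIntegrable_fun : LocallyIntegrable Φ
  locallyIntegrable_grad : LocallyIntegrable G
  integral_eq : ∀ φ : R3 → ℝ, ContDiff ℝ ∞ φ → HasCompactSupport φ → ∀ v : R3,
    ∫ x, Φ x * fderiv ℝ φ x v = -∫ x, ⟪G x, v⟫_ℝ * φ x

/-- `‖∇Φ‖_{L²(ℝ³)}`, with value `∞` if `Φ` has no weak gradient (a weak gradient is unique
almost everywhere, so the infimum is taken over a single value). -/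
def gradL2Norm (Φ : R3 → ℝ) : ℝ≥0∞ :=
  ⨅ (G : R3 → R3) (_ : IsWeakGradient Φ G), eLpNorm G 2 volume

/-- `(1 / 4π) ‖∇Φ‖²_{L²(ℝ³)}` for the potential `Φ` generated by `ρ`. -/
def fieldEnergy (ρ : R3 → ℝ) : ℝ≥0∞ :=
  ENNReal.ofReal (1 / (4 * Real.pi)) * gradL2Norm (potential ρ) ^ 2

/-! ### Traces and densities of nonnegative operators on `L²(ℝ³)` -/

/-- The square root `γ^{1/2}` of a nonnegative bounded operator on a complex Hilbert space. -/
def opSqrt {H : Type*} [NormedAddCommGroup H] [InnerProductSpace ℂ H] [CompleteSpace H]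
    (γ : H →L[ℂ] H) : H →L[ℂ] H := CFC.sqrt γ

/-- The index set of an orthonormal basis of `L²(ℝ³)`. -/
def basisIndex : Set L2R3 := (exists_hilbertBasis ℂ L2R3).choose

/-- An orthonormal basis `(eᵢ)` of `L²(ℝ³)`. -/
def onb : HilbertBasis basisIndex ℂ L2R3 := (exists_hilbertBasis ℂ L2R3).choose_spec.choose

/-- `Tr γ = ∑ᵢ ⟨eᵢ, γ eᵢ⟩` for a nonnegative bounded operator `γ`. -/
def trace (γ : L2R3 →L[ℂ] L2R3) : ℝ≥0∞ :=
  ∑' i, ENNReal.ofReal (RCLike.re ⟪onb i, γ (onb i)⟫_ℂ)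

/-- `‖m(-i∇) u‖²_{L²}` for the Fourier multiplier with symbol `m` (possibly `∞`). Mathlib's
Fourier transform has the phase `e^{-2πi x·ξ}`, so that the frequency variable of the
convention `∫ u(x) e^{-i x·ξ} dx` is `2πξ`. -/
def multiplierNormSq (m : R3 → ℝ) (u : L2R3) : ℝ≥0∞ :=
  ∫⁻ ξ, ‖m ((2 * Real.pi) • ξ)‖ₑ ^ 2 * ‖(𝓕 u : L2R3) ξ‖ₑ ^ 2

/-- `Tr (m(-i∇) γ m(-i∇)) = ‖m(-i∇) γ^{1/2}‖²_HS = ∑ᵢ ‖m(-i∇) γ^{1/2} eᵢ‖²` for a nonnegative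
bounded operator `γ` and a real symbol `m` (possibly `∞`). -/
def multiplierTrace (m : R3 → ℝ) (γ : L2R3 →L[ℂ] L2R3) : ℝ≥0∞ :=
  ∑' i, multiplierNormSq m (opSqrt γ (onb i))

/-- The density `ρ_γ(x) = γ(x, x)` of a nonnegative operator `γ` of finite trace: writing
`ψᵢ = γ^{1/2} eᵢ`, one has `γ = ∑ᵢ |ψᵢ⟩⟨ψᵢ|`, hence the kernel
`γ(x, x') = ∑ᵢ ψᵢ(x) conj(ψᵢ(x'))`. -/
def density (γ : L2R3 →L[ℂ] L2R3) (x : R3) : ℝ :=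
  (∑' i, ‖(opSqrt γ (onb i) : L2R3) x‖ₑ ^ 2).toReal

/-! ### The quantum critical mass -/

/-- The semiclassical trace `Tr^ħ(γ) = (2πħ)³ Tr γ`. -/
def scTrace (ħ : ℝ) (γ : L2R3 →L[ℂ] L2R3) : ℝ≥0∞ :=
  ENNReal.ofReal ((2 * Real.pi * ħ) ^ 3) * trace γ

/-- The kinetic term `Tr^ħ(|ħ∇|^{1/2} γ |ħ∇|^{1/2})`. -/
def scKinetic (ħ : ℝ) (γ : L2R3 →L[ℂ] L2R3) : ℝ≥0∞ :=
  ENNReal.ofReal ((2 * Real.pi * ħ) ^ 3) * multiplierTrace (fun ξ => (ħ * ‖ξ‖) ^ (1 / 2 : ℝ)) γ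

/-- The semiclassical density `ρ_γ^ħ = (2πħ)³ ρ_γ`. -/
def scDensity (ħ : ℝ) (γ : L2R3 →L[ℂ] L2R3) (x : R3) : ℝ :=
  (2 * Real.pi * ħ) ^ 3 * density γ x

/-- The quantum admissible class: compact self-adjoint `γ` with `0 ≤ γ ≤ 1` and
`Tr ((1 - Δ)^{1/4} γ (1 - Δ)^{1/4}) < ∞`. -/
structure IsQuantumAdmissible (γ : L2R3 →L[ℂ] L2R3) : Prop where
  isCompact : IsCompactOperator γ
  isSelfAdjoint : IsSelfAdjoint γ
  nonneg : 0 ≤ γ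
  le_one : γ ≤ 1
  trace_lt_top : multiplierTrace (fun ξ => (1 + ‖ξ‖ ^ 2) ^ (1 / 4 : ℝ)) γ < ⊤

/-- The quotient minimized by the quantum sharp constant. -/
def quantumQuotient (ħ : ℝ) (γ : L2R3 →L[ℂ] L2R3) : ℝ≥0∞ :=
  ‖γ‖ₑ ^ (1 / 3 : ℝ) * scTrace ħ γ ^ (2 / 3 : ℝ) * scKinetic ħ γ / fieldEnergy (scDensity ħ γ)

/-- `K_qm`, the infimum of the quotient over the nonzero admissible operators. -/
def quantumConstant (ħ : ℝ) : ℝ≥0∞ :=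
  ⨅ (γ : L2R3 →L[ℂ] L2R3) (_ : IsQuantumAdmissible γ) (_ : γ ≠ 0), quantumQuotient ħ γ

/-- `M_qm = (2 K_qm)^{3/2}`. -/
def quantumCriticalMass (ħ : ℝ) : ℝ≥0∞ := (2 * quantumConstant ħ) ^ (3 / 2 : ℝ)

/-! ### The classical critical mass -/

/-- The density `ρ_f(q) = ∫ f(q, p) dp` of a phase space distribution. -/
def kineticDensity (f : R3 × R3 → ℝ) (q : R3) : ℝ := ∫ p, f (q, p)

/-- The classical admissible class: `f ∈ L¹`, `0 ≤ f ≤ 1` a.e., and `|p| f ∈ L¹`. -/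
structure IsClassicalAdmissible (f : R3 × R3 → ℝ) : Prop where
  integrable : Integrable f
  mem_Icc : ∀ᵐ z, 0 ≤ f z ∧ f z ≤ 1
  integrable_momentum : Integrable fun z => ‖z.2‖ * f z

/-- The quotient minimized by the classical sharp constant. -/
def classicalQuotient (f : R3 × R3 → ℝ) : ℝ≥0∞ :=
  eLpNorm f ⊤ volume ^ (1 / 3 : ℝ) * eLpNorm f 1 volume ^ (2 / 3 : ℝ) *
    eLpNorm (fun z => ‖z.2‖ * f z) 1 volume / fieldEnergy (kineticDensity f)

/-- `K_cm`, the infimum of the quotient over the admissible distributions that do not vanish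
almost everywhere. -/
def classicalConstant : ℝ≥0∞ :=
  ⨅ (f : R3 × R3 → ℝ) (_ : IsClassicalAdmissible f) (_ : ¬ f =ᵐ[volume] 0), classicalQuotient f

/-- `M_cm = (2 K_cm)^{3/2}`. -/
def classicalCriticalMass : ℝ≥0∞ := (2 * classicalConstant) ^ (3 / 2 : ℝ)

end

end Chandrasekhar

/-! Every classical `f` is approached by quantum trial states. Take a smooth compactly supported
profile `g` with `∫ g² = 1`, the wave packets `φ_z(x) = e^{i x·p/ħ} g(x - q)` for `z = (q, p)`, and
the operator `γ = (2πħ)⁻³ ∫ f(z) |φ_z⟩⟨φ_z| dz`. Plancherel in `p` gives the resolution of the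
identity, hence the Bessel bound that makes `‖γ‖ ≤ ‖f‖_∞`. The trace `Tr^ħ γ` is exactly `‖f‖₁`, the
density is exactly `ρ_f * g²`, and the kinetic term exceeds `‖|p| f‖₁` by at most `ħ ‖f‖₁` times a
finite constant depending on `g` (`exists_semiclassical_operator`).

Since `K_qm` does not depend on `ħ` (`quantumConstant_eq`), letting `ħ → 0` with `g` fixed removes
the kinetic error and bounds `K_qm` times the field energy of `ρ_f * g²` by the classical numerator.
Then `g²` concentrates at the origin. Lower semicontinuity of the Dirichlet norm suffices for this
second limit (`fieldEnergy_le_of_mollification`): a common bound on the energies of the mollified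
densities passes to `ρ_f`.

The operator `γ` is realised as `V† V`, with `V u = ⟨φ_z, u⟩` mapping into `L²` of the measure
`(2πħ)⁻³ |f| dz`. Traces and densities are defined through `γ^{1/2}`, which is never computed: only
`‖γ^{1/2} x‖ = ‖V x‖` enters. -/

namespace Chandrasekhar

open Filter Topology ContinuousLinearMap
open scoped InnerProduct

/-! ### Hilbert-Schmidt operators and square roots of `V† V`. -/

section HilbertSpace

variable {H K ι : Type*} [NormedAddCommGroup H] [InnerProductSpace ℂ H]
  [NormedAddCommGroup K] [InnerProductSpace ℂ K]

/-- Parseval's identity. -/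
lemma tsum_enorm_inner_sq (b : HilbertBasis ι ℂ H) (x : H) :
    ∑' i, ‖⟪b i, x⟫_ℂ‖ₑ ^ 2 = ‖x‖ₑ ^ 2 := by
  have h1 : HasSum (fun i => ‖⟪b i, x⟫_ℂ‖ ^ 2) (‖x‖ ^ 2) := by
    have h := Complex.hasSum_re (b.hasSum_inner_mul_inner x x)
    have e1 : (⟪x, x⟫_ℂ).re = ‖x‖ ^ 2 := by
      rw [inner_self_eq_norm_sq_to_K]; norm_cast
    rw [e1] at h
    convert h using 2 with i
    exact ((inner_mul_symm_re_eq_norm (𝕜 := ℂ) x (b i)).trans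
      (by rw [norm_mul, norm_inner_symm x, sq])).symm
  have h2 := ENNReal.ofReal_tsum_of_nonneg (fun i => sq_nonneg ‖⟪b i, x⟫_ℂ‖) h1.summable
  rw [h1.tsum_eq, ENNReal.ofReal_pow (norm_nonneg _), ofReal_norm] at h2
  rw [h2]
  exact tsum_congr fun i => by rw [ENNReal.ofReal_pow (norm_nonneg _), ofReal_norm]

lemma enorm_inner_comm (x y : H) : ‖⟪x, y⟫_ℂ‖ₑ = ‖⟪y, x⟫_ℂ‖ₑ := by
  rw [← ofReal_norm, norm_inner_symm, ofReal_norm]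

/-- Distinct basis vectors lie at distance `√2`, so the balls of radius `1/2` around them are
disjoint. Countability permits exchanging basis sums with integrals. -/
lemma countable_of_hilbertBasis [TopologicalSpace.SeparableSpace H]
    (b : HilbertBasis ι ℂ H) : Countable ι := by
  have h : (Set.univ : Set ι).PairwiseDisjoint fun i => Metric.ball (b i) (1 / 2) := by
    intro i _ j _ hij
    refine Metric.ball_disjoint_ball ?_
    have h2 : ‖b i - b j‖ ^ 2 = 2 := by
      rw [@norm_sub_sq ℂ, b.orthonormal.1, b.orthonormal.1, b.orthonormal.2 hij]; norm_num
    rw [dist_eq_norm]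
    nlinarith [norm_nonneg (b i - b j)]
  exact Set.countable_univ_iff.mp (h.countable_of_isOpen (fun _ _ => Metric.isOpen_ball)
    fun i _ => ⟨b i, by simp⟩)

variable [CompleteSpace H] [CompleteSpace K]

/-- The bound is proved for the adjoint: Parseval gives `‖T† y‖² = ∑ |⟨T bᵢ, y⟩|²`, and
Cauchy-Schwarz applies termwise. -/
lemma enorm_sq_le_tsum (b : HilbertBasis ι ℂ H) (T : H →L[ℂ] K) :
    ‖T‖ₑ ^ 2 ≤ ∑' i, ‖T (b i)‖ₑ ^ 2 := by
  set s := ∑' i, ‖T (b i)‖ₑ ^ 2 with hs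
  by_cases htop : s = ⊤
  · simp [htop]
  have key : ∀ y : K, ‖(T†) y‖ ≤ √s.toReal * ‖y‖ := by
    intro y
    have h : ‖(T†) y‖ₑ ^ 2 ≤ s * ‖y‖ₑ ^ 2 := by
      rw [← tsum_enorm_inner_sq b, hs, ← ENNReal.tsum_mul_right]
      refine ENNReal.tsum_le_tsum fun i => ?_
      rw [adjoint_inner_right, ← mul_pow]
      gcongr
      rw [← ofReal_norm, ← ofReal_norm, ← ofReal_norm, ← ENNReal.ofReal_mul (norm_nonneg _)]
      exact ENNReal.ofReal_le_ofReal (norm_inner_le_norm _ _)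
    have h' := ENNReal.toReal_mono (by finiteness) h
    rw [ENNReal.toReal_mul, ENNReal.toReal_pow, ENNReal.toReal_pow, toReal_enorm, toReal_enorm] at h'
    refine abs_le_of_sq_le_sq' ?_ (by positivity) |>.2
    rw [mul_pow, Real.sq_sqrt ENNReal.toReal_nonneg]
    exact h'
  have h3 : ‖T‖ ≤ √s.toReal := by
    rw [← LinearIsometryEquiv.norm_map adjoint T]
    exact ContinuousLinearMap.opNorm_le_bound _ (by positivity) key
  rw [← ofReal_norm, ← ENNReal.ofReal_pow (norm_nonneg _)]
  refine ENNReal.ofReal_le_of_le_toReal ?_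
  rw [← Real.sq_sqrt (ENNReal.toReal_nonneg (a := s))]
  gcongr

/-- Hilbert-Schmidt operators are compact. -/
lemma isCompactOperator_of_tsum_lt_top (b : HilbertBasis ι ℂ H) (T : H →L[ℂ] K)
    (hT : ∑' i, ‖T (b i)‖ₑ ^ 2 ≠ ⊤) : IsCompactOperator T := by
  classical
  -- Finite-rank truncations: `T - F s` kills `b i` for `i ∈ s`, so its squared norm is at most a
  -- tail of the convergent series.
  let F : Finset ι → H →L[ℂ] K := fun s => ∑ i ∈ s, (innerSL ℂ (b i)).smulRight (T (b i))
  have hF : ∀ s i, (T - F s) (b i) = if i ∈ s then 0 else T (b i) := by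
    intro s i
    have : F s (b i) = if i ∈ s then T (b i) else 0 := by
      simp only [F, sum_apply, ContinuousLinearMap.smulRight_apply,
        innerSL_apply_apply, orthonormal_iff_ite.1 b.orthonormal]
      simp
    rw [sub_apply, this]
    split_ifs <;> simp
  refine isCompactOperator_of_tendsto (l := atTop) (F := F) ?_ (Eventually.of_forall fun s => ?_)
  · rw [tendsto_iff_edist_tendsto_0]
    have h0 := ENNReal.tendsto_tsum_compl_atTop_zero hT
    have h1 : Tendsto (fun s => edist (F s) T ^ 2) atTop (𝓝 0) := by
      refine tendsto_of_tendsto_of_tendsto_of_le_of_le tendsto_const_nhds h0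
        (fun _ => zero_le) fun s => ?_
      rw [edist_comm, edist_eq_enorm_sub]
      refine (enorm_sq_le_tsum b _).trans ?_
      have h3 : ∑' i : {x // x ∉ s}, ‖T (b i)‖ₑ ^ 2
          = ∑' i, Set.indicator {x | x ∉ s} (fun i => ‖T (b i)‖ₑ ^ 2) i :=
        tsum_subtype {x | x ∉ s} (fun i => ‖T (b i)‖ₑ ^ 2)
      rw [h3]
      refine ENNReal.tsum_le_tsum fun i => ?_
      rw [hF]
      by_cases hi : i ∈ s <;> simp [hi]
    have h2 := (ENNReal.continuous_rpow_const (y := 1 / 2)).tendsto 0 |>.comp h1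
    rw [ENNReal.zero_rpow_of_pos (by norm_num)] at h2
    refine h2.congr fun s => ?_
    simp only [Function.comp]
    rw [← ENNReal.rpow_natCast, ← ENNReal.rpow_mul]
    norm_num
  · have h1 : ∀ i, IsCompactOperator ((innerSL ℂ (b i)).smulRight (T (b i))) := fun i =>
      (isCompactOperator_of_locallyCompactSpace_dom (innerSL ℂ (b i))).clm_comp
        (ContinuousLinearMap.toSpanSingleton ℂ (T (b i)))
    induction s using Finset.induction_on with
    | empty => exact isCompactOperator_zero
    | insert i s hi ih =>
      have : F (insert i s) = (innerSL ℂ (b i)).smulRight (T (b i)) + F s := Finset.sum_insert hi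
      rw [this]
      exact (h1 i).add ih

/-- The square root is self-adjoint and squares to `V† V`, so Parseval sums the left side to `‖√(V†
V) x‖² = ⟨x, V† V x⟩`. -/
lemma tsum_enorm_inner_opSqrt_sq (b : HilbertBasis ι ℂ H) (V : H →L[ℂ] K) (x : H) :
    ∑' i, ‖⟪x, opSqrt (V† ∘L V) (b i)⟫_ℂ‖ₑ ^ 2 = ‖V x‖ₑ ^ 2 := by
  set γ := V† ∘L V with hγ
  have h0 : 0 ≤ γ := by
    rw [ContinuousLinearMap.nonneg_iff_isPositive]
    exact ContinuousLinearMap.isPositive_adjoint_comp_self V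
  have hs : (opSqrt γ)† = opSqrt γ := by
    have := CFC.sqrt_nonneg γ
    rw [ContinuousLinearMap.nonneg_iff_isPositive] at this
    exact this.isSelfAdjoint
  have hsq : opSqrt γ ∘L opSqrt γ = γ := CFC.sqrt_mul_sqrt_self γ h0
  have h1 : ‖opSqrt γ x‖ₑ ^ 2 = ‖V x‖ₑ ^ 2 := by
    have : ‖opSqrt γ x‖ ^ 2 = ‖V x‖ ^ 2 := by
      rw [apply_norm_sq_eq_inner_adjoint_left, hs, apply_norm_sq_eq_inner_adjoint_left, hsq]
    rw [← ofReal_norm, ← ofReal_norm, ← ENNReal.ofReal_pow (norm_nonneg _), this,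
      ENNReal.ofReal_pow (norm_nonneg _)]
  rw [← h1, ← tsum_enorm_inner_sq b]
  refine tsum_congr fun i => ?_
  rw [enorm_inner_comm, ← adjoint_inner_right, hs]

end HilbertSpace

end Chandrasekhar

namespace Chandrasekhar

open Filter Topology

/-! ### Scaling and lower semicontinuity of the field energy. -/

section WeakGradient

lemma IsWeakGradient.const_mul {Φ : R3 → ℝ} {G : R3 → R3} (h : IsWeakGradient Φ G) (c : ℝ) :
    IsWeakGradient (fun x => c * Φ x) (fun x => c • G x) where
  locallyIntegrable_fun := h.locallyIntegrable_fun.smul c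
  locallyIntegrable_grad := h.locallyIntegrable_grad.smul c
  integral_eq φ h1 h2 v := by
    simp only [mul_assoc, inner_smul_left, integral_const_mul, h.integral_eq φ h1 h2 v]
    simp

lemma gradL2Norm_const_mul_le (Φ : R3 → ℝ) {c : ℝ} (hc : 0 < c) :
    gradL2Norm (fun x => c * Φ x) ≤ ENNReal.ofReal c * gradL2Norm Φ := by
  unfold gradL2Norm
  have hc0 : ENNReal.ofReal c ≠ 0 := by simpa using hc
  rw [ENNReal.mul_iInf_of_ne hc0 ENNReal.ofReal_ne_top]
  refine le_iInf fun G => ?_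
  rw [ENNReal.mul_iInf_of_ne hc0 ENNReal.ofReal_ne_top]
  refine le_iInf fun hG => ?_
  refine (iInf₂_le (fun x => c • G x) (hG.const_mul c)).trans ?_
  refine (eLpNorm_const_smul_le (c := c) (f := G)).trans ?_
  rw [Real.enorm_of_nonneg hc.le]

lemma gradL2Norm_const_mul (Φ : R3 → ℝ) {c : ℝ} (hc : 0 < c) :
    gradL2Norm (fun x => c * Φ x) = ENNReal.ofReal c * gradL2Norm Φ := by
  refine (gradL2Norm_const_mul_le Φ hc).antisymm ?_
  have h := gradL2Norm_const_mul_le (fun x => c * Φ x) (inv_pos.2 hc)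
  simp only [inv_mul_cancel_left₀ hc.ne'] at h
  calc ENNReal.ofReal c * gradL2Norm Φ
      ≤ ENNReal.ofReal c * (ENNReal.ofReal c⁻¹ * gradL2Norm (fun x => c * Φ x)) := by gcongr
    _ = gradL2Norm (fun x => c * Φ x) := by
      rw [← mul_assoc, ← ENNReal.ofReal_mul hc.le, mul_inv_cancel₀ hc.ne', ENNReal.ofReal_one,
        one_mul]

lemma potential_const_mul (ρ : R3 → ℝ) (c : ℝ) :
    potential (fun x => c * ρ x) = fun x => c * potential ρ x := by
  ext x
  simp only [potential, mul_div_assoc, integral_const_mul, mul_neg]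

lemma fieldEnergy_const_mul (ρ : R3 → ℝ) {c : ℝ} (hc : 0 < c) :
    fieldEnergy (fun x => c * ρ x) = ENNReal.ofReal c ^ 2 * fieldEnergy ρ := by
  rw [fieldEnergy, fieldEnergy, potential_const_mul, gradL2Norm_const_mul _ hc]
  ring

lemma potential_congr {ρ ρ' : R3 → ℝ} (h : ρ =ᵐ[volume] ρ') : potential ρ = potential ρ' := by
  ext x
  simp only [potential]
  congr 1
  refine integral_congr_ae ?_
  filter_upwards [h] with y hy
  rw [hy]

lemma fieldEnergy_congr {ρ ρ' : R3 → ℝ} (h : ρ =ᵐ[volume] ρ') :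
    fieldEnergy ρ = fieldEnergy ρ' := by
  rw [fieldEnergy, fieldEnergy, potential_congr h]

/-- The Dirichlet norm is lower semicontinuous under distributional convergence. -/
lemma gradL2Norm_le_of_tendsto {Φ : R3 → ℝ} {Ψ : ℕ → R3 → ℝ} {C : ℝ≥0∞}
    (hΦ : LocallyIntegrable Φ) (hΨ : ∀ n, gradL2Norm (Ψ n) ≤ C)
    (hlim : ∀ φ : R3 → ℝ, ContDiff ℝ ∞ φ → HasCompactSupport φ → ∀ v : R3,
      Tendsto (fun n => ∫ x, Ψ n x * fderiv ℝ φ x v) atTop (𝓝 (∫ x, Φ x * fderiv ℝ φ x v))) :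
    gradL2Norm Φ ≤ C := by
  by_cases hC : C = ⊤
  · simp [hC]
  -- The slack `ε` turns the bound on an infimum into actual weak gradients of norm below `C + ε`.
  refine ENNReal.le_of_forall_pos_le_add fun ε hε _ => ?_
  have hD : C + ε ≠ ⊤ := by finiteness
  set D := C + ε with hDdef
  have hex : ∀ n, ∃ G : R3 → R3, IsWeakGradient (Ψ n) G ∧ eLpNorm G 2 volume < D := by
    intro n
    have h : gradL2Norm (Ψ n) < D :=
      (hΨ n).trans_lt (ENNReal.lt_add_right hC (by simpa using hε.ne'))
    simp only [gradL2Norm, iInf_lt_iff] at h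
    obtain ⟨G, hG, h⟩ := h
    exact ⟨G, hG, h⟩
  choose G hG hGD using hex
  have hGm : ∀ n, MemLp (G n) 2 volume := fun n =>
    ⟨(hG n).locallyIntegrable_grad.aestronglyMeasurable, (hGD n).trans_le le_top⟩
  let g : ℕ → Lp R3 2 (volume : Measure R3) := fun n => (hGm n).toLp
  let W : ℕ → WeakDual ℝ (Lp R3 2 (volume : Measure R3)) := fun n =>
    StrongDual.toWeakDual (InnerProductSpace.toDual ℝ _ (g n))
  have hcpt := WeakDual.isCompact_closedBall
    (0 : StrongDual ℝ (Lp R3 2 (volume : Measure R3))) D.toReal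
  have hgD : ∀ n, ‖g n‖ ≤ D.toReal := by
    intro n
    rw [Lp.norm_toLp]
    exact ENNReal.toReal_mono hD (hGD n).le
  -- Banach-Alaoglu along an ultrafilter finer than `atTop` replaces the extraction of a weakly
  -- convergent subsequence. The Riesz representative of the limit is the weak gradient of `Φ`.
  obtain ⟨ℓ, hℓ, hle⟩ := hcpt.ultrafilter_le_nhds' ((Ultrafilter.of atTop).map W) (by
    refine Ultrafilter.mem_map.2 (Filter.univ_mem' fun n => ?_)
    simpa [W] using hgD n)
  have hWlim : ∀ u, Tendsto (fun n => ⟪g n, u⟫_ℝ) (Ultrafilter.of (atTop : Filter ℕ))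
      (𝓝 (ℓ u)) := by
    intro u
    exact ((WeakDual.eval_continuous u).tendsto ℓ).comp (show Tendsto W _ _ from hle)
  obtain ⟨h, hh⟩ := (InnerProductSpace.toDual ℝ (Lp R3 2 (volume : Measure R3))).surjective
    (WeakDual.toStrongDual ℓ)
  have hhℓ : ∀ u, ⟪h, u⟫_ℝ = ℓ u := fun u => by
    rw [← InnerProductSpace.toDual_apply_apply (𝕜 := ℝ), hh]; rfl
  have hnorm : ‖h‖ ≤ D.toReal := by
    rw [← (InnerProductSpace.toDual ℝ (Lp R3 2 (volume : Measure R3))).norm_map h, hh]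
    simpa using hℓ
  have hgrad : IsWeakGradient Φ h := by
    refine ⟨hΦ, (Lp.memLp h).locallyIntegrable (by norm_num), fun φ h1 h2 v => ?_⟩
    have hmem : MemLp (fun x => φ x • v) 2 (volume : Measure R3) :=
      (h1.continuous.smul continuous_const).memLp_of_hasCompactSupport (h2.smul_right)
    have e1 : ∀ n, ⟪g n, hmem.toLp⟫_ℝ = -∫ x, Ψ n x * fderiv ℝ φ x v := by
      intro n
      rw [(hG n).integral_eq φ h1 h2 v, neg_neg, L2.inner_def]
      refine integral_congr_ae ?_
      filter_upwards [(hGm n).coeFn_toLp, hmem.coeFn_toLp] with x hx hx'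
      rw [hx, hx', inner_smul_right, mul_comm]
    have e2 : ⟪h, hmem.toLp⟫_ℝ = ∫ x, ⟪h x, v⟫_ℝ * φ x := by
      rw [L2.inner_def]
      refine integral_congr_ae ?_
      filter_upwards [hmem.coeFn_toLp] with x hx'
      rw [hx', inner_smul_right, mul_comm]
    have l1 := hWlim hmem.toLp
    simp only [e1] at l1
    rw [← hhℓ, e2] at l1
    have l2 := ((hlim φ h1 h2 v).neg).mono_left (Ultrafilter.of_le (atTop : Filter ℕ))
    rw [← tendsto_nhds_unique l2 l1, neg_neg]
  refine (iInf₂_le _ hgrad).trans ?_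
  rw [← Lp.enorm_def, ← ofReal_norm]
  exact ENNReal.ofReal_le_of_le_toReal hnorm

end WeakGradient

end Chandrasekhar

namespace Chandrasekhar

open Filter Topology Metric

/-! ### Coulomb potentials of integrable densities and their mollification. -/

section Potential

lemma integrableOn_norm_inv_ball (r : ℝ) :
    IntegrableOn (fun x : R3 => ‖x‖⁻¹) (ball 0 r) := by
  rw [integrableOn_fun_norm_addHaar volume (f := fun t : ℝ => t⁻¹)]
  have h : IntegrableOn (fun t : ℝ => t) (Set.Ioo 0 r) :=
    (continuous_id.integrableOn_Icc (a := (0 : ℝ)) (b := r)).mono_set Set.Ioo_subset_Icc_self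
  refine h.congr_fun (fun t ht => ?_) measurableSet_Ioo
  have : t ≠ 0 := ht.1.ne'
  simp only [finrank_euclideanSpace, Fintype.card_fin, smul_eq_mul]
  field_simp

lemma locallyIntegrable_norm_inv : LocallyIntegrable (fun x : R3 => ‖x‖⁻¹) := by
  intro x
  refine ⟨ball 0 (‖x‖ + 1), isOpen_ball.mem_nhds (by simp), integrableOn_norm_inv_ball _⟩

/-- The kernel is split at `‖x - y‖ = 1`: boundedness of `ψ` controls the near part and
integrability the far part, both uniformly in `y`. -/
lemma exists_potential_bound {ψ : R3 → ℝ} {M : ℝ} (hψ : Integrable ψ) (hM : ∀ x, |ψ x| ≤ M) :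
    ∃ B : ℝ, ∀ y, Integrable (fun x => ψ x / ‖x - y‖) ∧ ∫ x, |ψ x / ‖x - y‖| ≤ B := by
  let κ : R3 → ℝ := (ball (0 : R3) 1).indicator fun x => ‖x‖⁻¹
  have hκ : Integrable κ := (integrableOn_norm_inv_ball 1).integrable_indicator measurableSet_ball
  refine ⟨M * (∫ x, κ x) + ∫ x, |ψ x|, fun y => ?_⟩
  have hdom : Integrable fun x => M * κ (x - y) + |ψ x| :=
    ((hκ.comp_sub_right y).const_mul M).add hψ.abs
  have hle : ∀ x, |ψ x / ‖x - y‖| ≤ M * κ (x - y) + |ψ x| := by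
    intro x
    have hM0 : 0 ≤ M := (abs_nonneg _).trans (hM x)
    rw [abs_div, abs_norm, div_eq_mul_inv]
    by_cases h : x - y ∈ ball (0 : R3) 1
    · simp only [κ, Set.indicator_of_mem h]
      have := mul_le_mul_of_nonneg_right (hM x) (inv_nonneg.2 (norm_nonneg (x - y)))
      linarith [abs_nonneg (ψ x)]
    · simp only [κ, Set.indicator_of_notMem h, mul_zero, zero_add]
      have h1 : 1 ≤ ‖x - y‖ := by simpa using h
      exact mul_le_of_le_one_right (abs_nonneg _) (inv_le_one_of_one_le₀ h1)
  have hint : Integrable fun x => ψ x / ‖x - y‖ := by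
    refine hdom.mono' ?_ (Eventually.of_forall hle)
    exact hψ.aestronglyMeasurable.div₀ (by fun_prop)
  refine ⟨hint, (integral_mono hint.abs hdom hle).trans ?_⟩
  rw [integral_add ((hκ.comp_sub_right y).const_mul M) hψ.abs, integral_const_mul,
    integral_sub_right_eq_self κ]

/-- Integrating in the variable of `ψ` first gives a bound uniform in the other variable, so `ρ ∈
L¹` is enough. -/
lemma integrable_coulomb_pairing {ρ ψ : R3 → ℝ} {M : ℝ} (hρ : Integrable ρ) (hψ : Integrable ψ)
    (hM : ∀ x, |ψ x| ≤ M) :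
    Integrable fun p : R3 × R3 => ψ p.1 * (ρ p.2 / ‖p.1 - p.2‖) := by
  obtain ⟨B, hB⟩ := exists_potential_bound hψ hM
  have hmeas : AEStronglyMeasurable (fun p : R3 × R3 => ψ p.1 * (ρ p.2 / ‖p.1 - p.2‖))
      (volume.prod volume) :=
    hψ.aestronglyMeasurable.comp_fst.mul (hρ.aestronglyMeasurable.comp_snd.div₀ (by fun_prop))
  have e : ∀ x y, ψ x * (ρ y / ‖x - y‖) = ρ y * (ψ x / ‖x - y‖) := fun x y => by ring
  rw [Measure.volume_eq_prod, integrable_prod_iff' hmeas]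
  refine ⟨Eventually.of_forall fun y => ?_, ?_⟩
  · simp only [e]
    exact (hB y).1.const_mul _
  · refine (hρ.norm.mul_const B).mono' hmeas.norm.prod_swap.integral_prod_right'
      (Eventually.of_forall fun y => ?_)
    simp only [e, norm_mul, integral_const_mul]
    rw [norm_norm]
    refine mul_le_mul_of_nonneg_left ?_ (norm_nonneg _)
    rw [Real.norm_of_nonneg (by positivity)]
    exact (hB y).2

lemma locallyIntegrable_potential {ρ : R3 → ℝ} (hρ : Integrable ρ) :
    LocallyIntegrable (potential ρ) := by
  rw [locallyIntegrable_iff]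
  intro K hK
  rw [← integrable_indicator_iff hK.measurableSet]
  have h1 : Integrable (K.indicator fun _ => (1 : ℝ)) :=
    (integrable_indicator_iff hK.measurableSet).2
      (integrableOn_const hK.measure_lt_top.ne)
  have h := (integrable_coulomb_pairing (M := 1) hρ h1 fun x => by
    by_cases hx : x ∈ K <;> simp [hx]).integral_prod_left.neg
  refine h.congr (Eventually.of_forall fun x => ?_)
  by_cases hx : x ∈ K <;> simp [hx, potential]

/-- By symmetry of the kernel, the potential moves from the merely integrable `ρ` to the test
function, whose potential is far better behaved. -/
lemma integral_potential_mul {ρ ψ : R3 → ℝ} {M : ℝ} (hρ : Integrable ρ) (hψ : Integrable ψ)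
    (hM : ∀ x, |ψ x| ≤ M) :
    ∫ x, potential ρ x * ψ x = ∫ y, potential ψ y * ρ y := by
  have h := integral_integral_swap (f := fun x y : R3 => ψ x * (ρ y / ‖x - y‖))
    (integrable_coulomb_pairing hρ hψ hM)
  have e : ∀ x y, ψ x * (ρ y / ‖x - y‖) = ρ y * (ψ x / ‖y - x‖) := fun x y => by
    rw [norm_sub_rev]; ring
  calc ∫ x, potential ρ x * ψ x = -∫ x, ∫ y, ψ x * (ρ y / ‖x - y‖) := by
        rw [← integral_neg]
        congr with x
        rw [integral_const_mul, potential]; ring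
    _ = -∫ y, ∫ x, ψ x * (ρ y / ‖x - y‖) := by rw [h]
    _ = ∫ y, potential ψ y * ρ y := by
        rw [← integral_neg]
        congr with y
        simp only [e]
        rw [integral_const_mul, potential]; ring

lemma continuous_potential {ψ : R3 → ℝ} (hψ : Continuous ψ) (hc : HasCompactSupport ψ) :
    Continuous (potential ψ) :=
  (hc.continuous_convolution_left (ContinuousLinearMap.mul ℝ ℝ) (μ := volume) hψ
    locallyIntegrable_norm_inv).neg

lemma exists_norm_potential_le {ψ : R3 → ℝ} {M : ℝ} (hψ : Integrable ψ) (hM : ∀ x, |ψ x| ≤ M) :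
    ∃ B : ℝ, ∀ y, ‖potential ψ y‖ ≤ B := by
  obtain ⟨B, hB⟩ := exists_potential_bound hψ hM
  refine ⟨B, fun y => le_trans ?_ (hB y).2⟩
  rw [potential, norm_neg]
  simp only [norm_sub_rev y]
  exact norm_integral_le_integral_norm _

/-- The energy of a density is bounded by that of its mollifications. -/
lemma fieldEnergy_le_of_mollification {ρ : R3 → ℝ} (hρ : Integrable ρ) {η : ℕ → R3 → ℝ}
    (hcont : ∀ n, Continuous (η n)) (hcpt : ∀ n, HasCompactSupport (η n))
    (hnonneg : ∀ n x, 0 ≤ η n x) (heven : ∀ n x, η n (-x) = η n x)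
    (hint : ∀ n, ∫ x, η n x = 1)
    (hsupp : Tendsto (fun n => Function.support (η n)) atTop (𝓝 (0 : R3)).smallSets)
    {C : ℝ≥0∞} (hC : ∀ n, fieldEnergy (fun x => ∫ q, ρ q * η n (x - q)) ≤ C) :
    fieldEnergy ρ ≤ C := by
  have hηi : ∀ n, Integrable (η n) := fun n => (hcont n).integrable_of_hasCompactSupport (hcpt n)
  set a := ENNReal.ofReal (1 / (4 * Real.pi)) with ha
  have ha0 : a ≠ 0 := by rw [ha]; simp; positivity
  have hat : a ≠ ⊤ := ENNReal.ofReal_ne_top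
  -- Solved for the gradient norm, the energy bound has the form required by
  -- `gradL2Norm_le_of_tendsto`.
  have key : ∀ u : ℝ≥0∞, a * u ^ 2 ≤ C ↔ u ≤ (C / a) ^ (2 : ℝ)⁻¹ := by
    intro u
    rw [mul_comm, ← ENNReal.le_div_iff_mul_le (Or.inl ha0) (Or.inl hat),
      ENNReal.le_rpow_inv_iff two_pos, ENNReal.rpow_two]
  simp only [fieldEnergy, ← ha, key] at hC ⊢
  refine gradL2Norm_le_of_tendsto (locallyIntegrable_potential hρ) hC fun φ h1 h2 v => ?_
  set ψ : R3 → ℝ := fun x => fderiv ℝ φ x v with hψdef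
  have hψc : Continuous ψ := (h1.continuous_fderiv (by simp)).clm_apply continuous_const
  have hψs : HasCompactSupport ψ := h2.fderiv_apply (𝕜 := ℝ) v
  have hψi : Integrable ψ := hψc.integrable_of_hasCompactSupport hψs
  obtain ⟨M, hM⟩ := hψc.bounded_above_of_compact_support hψs
  obtain ⟨B, hB⟩ := exists_norm_potential_le hψi hM
  have hW := continuous_potential hψc hψs
  have hker : ∀ n, Integrable (fun p : R3 × R3 => ρ p.2 * η n (p.1 - p.2)) := fun n =>
    hρ.convolution_integrand (ContinuousLinearMap.mul ℝ ℝ) (hηi n)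
  -- Evenness of `η n` transfers the mollification to `potential ψ`, which is continuous and
  -- bounded. The convergence is then pointwise and dominated by `B * ‖ρ q‖`.
  have e1 : ∀ n, ∫ x, potential (fun x => ∫ q, ρ q * η n (x - q)) x * ψ x
      = ∫ q, (∫ x, η n (q - x) * potential ψ x) * ρ q := by
    intro n
    rw [integral_potential_mul (hker n).integral_prod_left hψi hM]
    have hsw := integral_integral_swap
      (f := fun x q : R3 => potential ψ x * (ρ q * η n (x - q)))
      ((hker n).bdd_mul (hW.comp continuous_fst).aestronglyMeasurable
        (Eventually.of_forall fun p => hB p.1))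
    simp only [← integral_const_mul]
    rw [hsw]
    congr with q
    rw [← integral_mul_const]
    congr with x
    rw [← neg_sub q x, heven]; ring
  change Tendsto (fun n => ∫ x, potential (fun x => ∫ q, ρ q * η n (x - q)) x * ψ x) atTop
    (𝓝 (∫ x, potential ρ x * ψ x))
  simp only [e1]
  rw [integral_potential_mul hρ hψi hM]
  refine tendsto_integral_of_dominated_convergence (fun q => B * ‖ρ q‖) (fun n => ?_)
    (hρ.norm.const_mul B) (fun n => Eventually.of_forall fun q => ?_)
    (Eventually.of_forall fun q => ?_)
  · refine Continuous.aestronglyMeasurable ?_ |>.mul hρ.aestronglyMeasurable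
    have := (hcpt n).continuous_convolution_left (ContinuousLinearMap.lsmul ℝ ℝ) (μ := volume)
      (hcont n) hW.locallyIntegrable
    convert this using 2 with q
    rw [convolution_lsmul_swap]; rfl
  · rw [norm_mul]
    refine mul_le_mul_of_nonneg_right ?_ (norm_nonneg _)
    have : ∫ x, η n (q - x) * B = B := by
      rw [integral_mul_const, integral_sub_left_eq_self, hint, one_mul]
    rw [← this]
    refine norm_integral_le_of_norm_le (((hηi n).comp_sub_left q).mul_const B)
      (Eventually.of_forall fun x => ?_)
    rw [norm_mul, Real.norm_of_nonneg (hnonneg n _)]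
    exact mul_le_mul_of_nonneg_left (hB x) (hnonneg n _)
  · refine Tendsto.mul_const _ ?_
    have := convolution_tendsto_right (μ := volume) (l := atTop) (φ := η)
      (g := fun _ => potential ψ) (k := fun _ => q) (x₀ := q) (z₀ := potential ψ q)
      (Eventually.of_forall hnonneg) (Eventually.of_forall hint) hsupp
      (Eventually.of_forall fun _ => hW.aestronglyMeasurable)
      ((hW.tendsto q).comp tendsto_snd) tendsto_const_nhds
    refine this.congr fun n => ?_
    rw [convolution_lsmul_swap]; rfl

end Potential

end Chandrasekhar

namespace Chandrasekhar

open Filter Topology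
open scoped InnerProduct

/-! ### Traces and densities of frame operators `V† V`. -/

section FrameOperator

lemma enorm_sq_eq_lintegral {α E : Type*} [MeasurableSpace α] {μ : Measure α}
    [NormedAddCommGroup E] (u : Lp E 2 μ) : ‖u‖ₑ ^ 2 = ∫⁻ x, ‖u x‖ₑ ^ 2 ∂μ := by
  rw [Lp.enorm_def, eLpNorm_eq_lintegral_rpow_enorm_toReal (by norm_num) (by norm_num)]
  simp only [ENNReal.toReal_ofNat, ENNReal.rpow_two, one_div]
  rw [← ENNReal.rpow_natCast, ← ENNReal.rpow_mul]
  norm_num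

/-- A Bessel family `φ` has a bounded analysis operator `u ↦ ⟨φ(·), u⟩`. -/
lemma exists_analysisOperator {α H : Type*} [MeasurableSpace α] {μ : Measure α}
    [NormedAddCommGroup H] [InnerProductSpace ℂ H] {φ : α → H}
    (hφ : ∀ u, AEStronglyMeasurable (fun z => ⟪φ z, u⟫_ℂ) μ) {C : ℝ≥0∞} (hC : C ≠ ⊤)
    (hbessel : ∀ u, ∫⁻ z, ‖⟪φ z, u⟫_ℂ‖ₑ ^ 2 ∂μ ≤ C * ‖u‖ₑ ^ 2) :
    ∃ V : H →L[ℂ] Lp ℂ 2 μ, ∀ u, ‖V u‖ₑ ^ 2 = ∫⁻ z, ‖⟪φ z, u⟫_ℂ‖ₑ ^ 2 ∂μ := by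
  have hmem : ∀ u, MemLp (fun z => ⟪φ z, u⟫_ℂ) 2 μ := by
    intro u
    refine ⟨hφ u, ?_⟩
    rw [eLpNorm_lt_top_iff_lintegral_rpow_enorm_lt_top (by norm_num) (by norm_num)]
    simp only [ENNReal.toReal_ofNat, ENNReal.rpow_two]
    exact (hbessel u).trans_lt (by finiteness)
  let T : H →ₗ[ℂ] Lp ℂ 2 μ :=
    { toFun := fun u => (hmem u).toLp
      map_add' := fun u v => by
        rw [← MemLp.toLp_add]
        exact MemLp.toLp_congr _ _ (Eventually.of_forall fun z => inner_add_right _ _ _)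
      map_smul' := fun c u => by
        rw [RingHom.id_apply, ← MemLp.toLp_const_smul]
        exact MemLp.toLp_congr _ _ (Eventually.of_forall fun z => inner_smul_right _ _ _) }
  have hT : ∀ u, ‖T u‖ₑ ^ 2 = ∫⁻ z, ‖⟪φ z, u⟫_ℂ‖ₑ ^ 2 ∂μ := by
    intro u
    rw [enorm_sq_eq_lintegral]
    refine lintegral_congr_ae ?_
    filter_upwards [(hmem u).coeFn_toLp] with z hz
    change ‖(hmem u).toLp _ z‖ₑ ^ 2 = _
    rw [hz]
  refine ⟨T.mkContinuous (√C.toReal) fun u => ?_, hT⟩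
  have h := ENNReal.toReal_mono (by finiteness) ((hT u).trans_le (hbessel u))
  rw [ENNReal.toReal_mul, ENNReal.toReal_pow, ENNReal.toReal_pow, toReal_enorm, toReal_enorm] at h
  refine abs_le_of_sq_le_sq' ?_ (by positivity) |>.2
  rwa [mul_pow, Real.sq_sqrt ENNReal.toReal_nonneg]

instance : Countable basisIndex :=
  haveI : Fact ((2 : ℝ≥0∞) ≠ ⊤) := ⟨by norm_num⟩
  countable_of_hilbertBasis onb

/-- Parseval for the truncation of `w` to `S`, with the indicator moved onto the basis vectors. It
expresses the local mass of `w` through inner products alone. -/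
lemma tsum_enorm_inner_indicator_sq {S : Set R3} (hS : MeasurableSet S) (w : L2R3) :
    ∑' j, ‖⟪((Lp.memLp (onb j)).indicator hS).toLp, w⟫_ℂ‖ₑ ^ 2 = ∫⁻ x in S, ‖w x‖ₑ ^ 2 := by
  let w' : L2R3 := ((Lp.memLp w).indicator hS).toLp
  have hw' : w' =ᵐ[volume] S.indicator w := MemLp.coeFn_toLp _
  have h1 : ∀ j, ⟪((Lp.memLp (onb j)).indicator hS).toLp, w⟫_ℂ = ⟪onb j, w'⟫_ℂ := by
    intro j
    rw [L2.inner_def, L2.inner_def]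
    refine integral_congr_ae ?_
    filter_upwards [hw', ((Lp.memLp (onb j)).indicator hS).coeFn_toLp] with x hx hx'
    rw [hx, hx']
    by_cases h : x ∈ S <;> simp [h]
  simp only [h1]
  rw [tsum_enorm_inner_sq, enorm_sq_eq_lintegral, ← lintegral_indicator hS]
  refine lintegral_congr_ae ?_
  filter_upwards [hw'] with x hx
  rw [hx]
  by_cases h : x ∈ S <;> simp [h]

variable {α : Type*} [MeasurableSpace α] {μ : Measure α} {φ : α → L2R3}
  {V : L2R3 →L[ℂ] Lp ℂ 2 μ}

/-- The diagonal of the frame operator `V† V` in the representation `U`. -/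
lemma tsum_enorm_opSqrt_sq_ae_eq [SFinite μ]
    (hφ : ∀ u, AEStronglyMeasurable (fun z => ⟪φ z, u⟫_ℂ) μ)
    (hV : ∀ u, ‖V u‖ₑ ^ 2 = ∫⁻ z, ‖⟪φ z, u⟫_ℂ‖ₑ ^ 2 ∂μ)
    (U : L2R3 ≃ₗᵢ[ℂ] L2R3) {h : α → R3 → ℝ≥0∞} (hh : Measurable (Function.uncurry h))
    (hU : ∀ z, (fun x => ‖U (φ z) x‖ₑ ^ 2) =ᵐ[volume] h z) :
    (fun x => ∑' i, ‖U (opSqrt (V† ∘L V) (onb i)) x‖ₑ ^ 2)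
      =ᵐ[volume] fun x => ∫⁻ z, h z x ∂μ := by
  have hm : ∀ u : L2R3, Measurable fun x => ‖u x‖ₑ ^ 2 := fun u =>
    (Lp.stronglyMeasurable u).measurable.enorm.pow_const 2
  -- Integration over an arbitrary `S` replaces point values by inner products, to which the square
  -- root identity applies.
  refine ae_eq_of_forall_setLIntegral_eq_of_sigmaFinite (Measurable.tsum fun i => hm _)
    hh.lintegral_prod_left' fun S hS _ => ?_
  let b : basisIndex → L2R3 := fun j => ((Lp.memLp (onb j)).indicator hS).toLp
  have hb : ∀ w : L2R3, ∑' j, ‖⟪b j, w⟫_ℂ‖ₑ ^ 2 = ∫⁻ x in S, ‖w x‖ₑ ^ 2 :=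
    tsum_enorm_inner_indicator_sq hS
  have hinner : ∀ j w, ⟪b j, U w⟫_ℂ = ⟪U.symm (b j), w⟫_ℂ := fun j w => by
    rw [← U.inner_map_map (U.symm (b j)), U.apply_symm_apply]
  calc ∫⁻ x in S, ∑' i, ‖U (opSqrt (V† ∘L V) (onb i)) x‖ₑ ^ 2
      = ∑' i, ∑' j, ‖⟪U.symm (b j), opSqrt (V† ∘L V) (onb i)⟫_ℂ‖ₑ ^ 2 := by
        rw [lintegral_tsum fun i => (hm _).aemeasurable]
        simp only [← hb, hinner]
    _ = ∑' j, ∫⁻ z, ‖⟪φ z, U.symm (b j)⟫_ℂ‖ₑ ^ 2 ∂μ := by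
        -- Summing over `i` first eliminates the square root.
        rw [ENNReal.tsum_comm]
        simp only [tsum_enorm_inner_opSqrt_sq onb V, hV]
    _ = ∫⁻ z, ∫⁻ x in S, h z x ∂volume ∂μ := by
        rw [← lintegral_tsum fun j => ((hφ _).enorm.pow_const 2)]
        refine lintegral_congr fun z => ?_
        simp only [enorm_inner_comm (φ z), ← hinner]
        rw [hb]
        exact lintegral_congr_ae (ae_restrict_of_ae (hU z))
    _ = ∫⁻ x in S, ∫⁻ z, h z x ∂μ := lintegral_lintegral_swap hh.aemeasurable

lemma trace_frameOperator
    (hφ : ∀ u, AEStronglyMeasurable (fun z => ⟪φ z, u⟫_ℂ) μ)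
    (hV : ∀ u, ‖V u‖ₑ ^ 2 = ∫⁻ z, ‖⟪φ z, u⟫_ℂ‖ₑ ^ 2 ∂μ) :
    trace (V† ∘L V) = ∫⁻ z, ‖φ z‖ₑ ^ 2 ∂μ := by
  have h : ∀ i, ENNReal.ofReal (RCLike.re ⟪onb i, (V† ∘L V) (onb i)⟫_ℂ)
      = ∫⁻ z, ‖⟪φ z, onb i⟫_ℂ‖ₑ ^ 2 ∂μ := by
    intro i
    rw [← ContinuousLinearMap.apply_norm_sq_eq_inner_adjoint_right,
      ENNReal.ofReal_pow (norm_nonneg _), ofReal_norm, hV]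
  rw [trace]
  simp only [h]
  rw [← lintegral_tsum fun j => ((hφ _).enorm.pow_const 2)]
  simp only [enorm_inner_comm (φ _), tsum_enorm_inner_sq]

lemma multiplierTrace_frameOperator [SFinite μ]
    (hφ : ∀ u, AEStronglyMeasurable (fun z => ⟪φ z, u⟫_ℂ) μ)
    (hV : ∀ u, ‖V u‖ₑ ^ 2 = ∫⁻ z, ‖⟪φ z, u⟫_ℂ‖ₑ ^ 2 ∂μ)
    {h : α → R3 → ℝ≥0∞} (hh : Measurable (Function.uncurry h))
    (hF : ∀ z, (fun x => ‖(𝓕 (φ z) : L2R3) x‖ₑ ^ 2) =ᵐ[volume] h z)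
    {m : R3 → ℝ} (hm : Measurable m) :
    multiplierTrace m (V† ∘L V)
      = ∫⁻ z, ∫⁻ ξ, ‖m ((2 * Real.pi) • ξ)‖ₑ ^ 2 * h z ξ ∂volume ∂μ := by
  have hm' : Measurable fun ξ : R3 => ‖m ((2 * Real.pi) • ξ)‖ₑ ^ 2 :=
    (hm.comp (measurable_const_smul _)).enorm.pow_const 2
  -- With `U` the Fourier transform, the diagonal is the momentum density; with `U` the identity it
  -- is the position density.
  have hae := tsum_enorm_opSqrt_sq_ae_eq hφ hV (Lp.fourierTransformₗᵢ R3 ℂ) hh hF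
  calc multiplierTrace m (V† ∘L V)
      = ∫⁻ ξ, ‖m ((2 * Real.pi) • ξ)‖ₑ ^ 2 *
          ∑' i, ‖Lp.fourierTransformₗᵢ R3 ℂ (opSqrt (V† ∘L V) (onb i)) ξ‖ₑ ^ 2 := by
        simp only [multiplierTrace, multiplierNormSq, ← ENNReal.tsum_mul_left]
        rw [lintegral_tsum fun i => ?_]
        · rfl
        · exact (hm'.mul ((Lp.stronglyMeasurable _).measurable.enorm.pow_const 2)).aemeasurable
    _ = ∫⁻ ξ, ∫⁻ z, ‖m ((2 * Real.pi) • ξ)‖ₑ ^ 2 * h z ξ ∂μ := by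
        refine lintegral_congr_ae ?_
        filter_upwards [hae] with ξ hξ
        rw [hξ, lintegral_const_mul]
        exact hh.of_uncurry_right
    _ = _ := by
        rw [lintegral_lintegral_swap]
        exact ((hm'.comp measurable_fst).mul (hh.comp measurable_swap)).aemeasurable

end FrameOperator

end Chandrasekhar

namespace Chandrasekhar

open Filter Topology SchwartzMap

/-! ### Coherent states and their resolution of the identity. -/

section CoherentStates

lemma lintegral_enorm_fourier_schwartz_sq (F : 𝓢(R3, ℂ)) :
    ∫⁻ k, ‖𝓕 (F : R3 → ℂ) k‖ₑ ^ 2 = ∫⁻ x, ‖F x‖ₑ ^ 2 := by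
  have h : ‖(𝓕 F).toLp 2‖ₑ ^ 2 = ‖F.toLp 2‖ₑ ^ 2 := by
    rw [← SchwartzMap.toLp_fourier_eq, ← ofReal_norm, Lp.norm_fourier_eq, ofReal_norm]
  rw [enorm_sq_eq_lintegral, enorm_sq_eq_lintegral] at h
  convert h using 1 <;> refine lintegral_congr_ae ?_
  · filter_upwards [(𝓕 F).coeFn_toLp 2] with x hx
    rw [hx, SchwartzMap.fourier_coe]
  · filter_upwards [F.coeFn_toLp 2] with x hx
    rw [hx]

lemma lintegral_comp_inv_smul (F : R3 → ℝ≥0∞) (hF : Measurable F) {c : ℝ} (hc : 0 < c) :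
    ∫⁻ x, F (c⁻¹ • x) = ENNReal.ofReal (c ^ 3) * ∫⁻ x, F x := by
  have h := Measure.map_addHaar_smul (volume : Measure R3) (inv_ne_zero hc.ne')
  rw [← lintegral_map hF (measurable_const_smul _), h, lintegral_smul_measure]
  simp [abs_of_pos hc]

/-- The wave packet `x ↦ e^{2πi x·p/c} g(x - q)`, where `z = (q, p)`. -/
noncomputable def wavePacket (c : ℝ) (g : R3 → ℝ) (z : R3 × R3) (x : R3) : ℂ :=
  (𝐞 ⟪x, c⁻¹ • z.2⟫_ℝ : ℂ) * (g (x - z.1) : ℂ)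

variable {c : ℝ} {g : R3 → ℝ}

lemma enorm_wavePacket (z : R3 × R3) (x : R3) : ‖wavePacket c g z x‖ₑ = ‖g (x - z.1)‖ₑ := by
  rw [wavePacket, enorm_mul, ← ofReal_norm (𝐞 _ : ℂ), Circle.norm_coe, ENNReal.ofReal_one, one_mul,
    ← ofReal_norm, Complex.norm_real, ofReal_norm]

lemma hasCompactSupport_translate (hc : HasCompactSupport g) (q : R3) :
    HasCompactSupport fun x => (g (x - q) : ℂ) :=
  (hc.comp_homeomorph (Homeomorph.subRight q)).comp_left (g := Complex.ofReal) rfl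

lemma contDiff_translate (hg : ContDiff ℝ ∞ g) (q : R3) :
    ContDiff ℝ ∞ fun x => (g (x - q) : ℂ) :=
  Complex.ofRealCLM.contDiff.comp (hg.comp (contDiff_id.sub contDiff_const))

lemma hasCompactSupport_wavePacket (hc : HasCompactSupport g) (z : R3 × R3) :
    HasCompactSupport (wavePacket c g z) :=
  (hasCompactSupport_translate hc z.1).mul_left

lemma contDiff_wavePacket (hg : ContDiff ℝ ∞ g) (z : R3 × R3) :
    ContDiff ℝ ∞ (wavePacket c g z) := by
  refine ContDiff.mul ?_ (contDiff_translate hg z.1)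
  simp only [Real.fourierChar_apply]
  refine (ContDiff.mul ?_ contDiff_const).cexp
  exact Complex.ofRealCLM.contDiff.comp (contDiff_const.mul (contDiff_id.inner ℝ contDiff_const))

/-- The wave packet as a vector of `L²`. -/
noncomputable def coherentState (c : ℝ) (hg : ContDiff ℝ ∞ g) (hc : HasCompactSupport g)
    (z : R3 × R3) : L2R3 :=
  ((hasCompactSupport_wavePacket (c := c) hc z).toSchwartzMap (contDiff_wavePacket hg z)).toLp 2

variable (hg : ContDiff ℝ ∞ g) (hs : HasCompactSupport g)

lemma coeFn_coherentState (z : R3 × R3) :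
    coherentState c hg hs z =ᵐ[volume] wavePacket c g z :=
  SchwartzMap.coeFn_toLp _ 2 volume

lemma enorm_coherentState_sq (z : R3 × R3) :
    ‖coherentState c hg hs z‖ₑ ^ 2 = ∫⁻ x, ‖g x‖ₑ ^ 2 := by
  rw [enorm_sq_eq_lintegral, ← lintegral_sub_right_eq_self (fun x => ‖g x‖ₑ ^ 2) z.1]
  refine lintegral_congr_ae ?_
  filter_upwards [coeFn_coherentState hg hs z] with x hx
  rw [hx, enorm_wavePacket]

lemma measurable_inner_coherentState (u : L2R3) :
    StronglyMeasurable fun z => ⟪coherentState c hg hs z, u⟫_ℂ := by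
  have h : ∀ z, ⟪coherentState c hg hs z, u⟫_ℂ = ∫ x, ⟪wavePacket c g z x, u x⟫_ℂ := by
    intro z
    rw [L2.inner_def]
    refine integral_congr_ae ?_
    filter_upwards [coeFn_coherentState hg hs z] with x hx
    rw [hx]
  simp only [h]
  refine StronglyMeasurable.integral_prod_right
    (f := fun (z : R3 × R3) (x : R3) => ⟪wavePacket c g z x, u x⟫_ℂ) ?_
  have hu : StronglyMeasurable fun p : (R3 × R3) × R3 => u p.2 :=
    (Lp.stronglyMeasurable u).comp_measurable measurable_snd
  have hw : Continuous fun p : (R3 × R3) × R3 => wavePacket c g p.1 p.2 := by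
    have := hg.continuous
    have := Real.continuous_fourierChar
    unfold wavePacket
    fun_prop
  exact hw.stronglyMeasurable.inner hu

/-- The Fourier transform of a coherent state is a translate of that of the profile. -/
lemma enorm_fourier_coherentState (z : R3 × R3) :
    (fun ξ => ‖(𝓕 (coherentState c hg hs z) : L2R3) ξ‖ₑ ^ 2)
      =ᵐ[volume] fun ξ => ‖𝓕 (fun x => (g x : ℂ)) (ξ - c⁻¹ • z.2)‖ₑ ^ 2 := by
  rw [coherentState, SchwartzMap.toLp_fourier_eq]
  filter_upwards [SchwartzMap.coeFn_toLp (𝓕 ((hasCompactSupport_wavePacket (c := c) hs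
    z).toSchwartzMap (contDiff_wavePacket hg z))) 2] with ξ hξ
  rw [hξ, SchwartzMap.fourier_coe]
  congr 1
  have h : 𝓕 (wavePacket c g z) ξ
      = (𝐞 (-⟪z.1, ξ - c⁻¹ • z.2⟫_ℝ) : ℂ) * 𝓕 (fun x => (g x : ℂ)) (ξ - c⁻¹ • z.2) := by
    rw [Real.fourier_eq, Real.fourier_eq, ← integral_const_mul,
      ← integral_sub_right_eq_self (fun x => (𝐞 (-⟪z.1, ξ - c⁻¹ • z.2⟫_ℝ) : ℂ) *
        𝐞 (-⟪x, ξ - c⁻¹ • z.2⟫_ℝ) • (g x : ℂ)) z.1]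
    congr with x
    simp only [Circle.smul_def, wavePacket, smul_eq_mul, ← mul_assoc, ← Circle.coe_mul,
      ← AddChar.map_add_eq_mul]
    congr 3
    simp only [inner_sub_left, inner_sub_right]
    ring
  change ‖𝓕 (wavePacket c g z) ξ‖ₑ = _
  rw [h, enorm_mul, ← ofReal_norm (𝐞 _ : ℂ), Circle.norm_coe, ENNReal.ofReal_one, one_mul]

/-- At fixed `q` the overlap is a Fourier transform in `p`, which opens the way to Plancherel. For
Schwartz `ψ` it is a classical Fourier integral. -/
lemma inner_coherentState_toLp (ψ : 𝓢(R3, ℂ)) (z : R3 × R3) :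
    ⟪coherentState c hg hs z, ψ.toLp 2⟫_ℂ
      = 𝓕 (fun x => (g (x - z.1) : ℂ) * ψ x) (c⁻¹ • z.2) := by
  rw [L2.inner_def, Real.fourier_eq]
  refine integral_congr_ae ?_
  filter_upwards [coeFn_coherentState (c := c) hg hs z, ψ.coeFn_toLp 2] with x hx hx'
  rw [hx, hx', RCLike.inner_apply]
  simp only [wavePacket, map_mul, Circle.smul_def, smul_eq_mul,
    AddChar.map_neg_eq_inv, Circle.coe_inv_eq_conj]
  rw [show (starRingEnd ℂ) (g (x - z.1) : ℂ) = (g (x - z.1) : ℂ) from Complex.conj_ofReal _]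
  ring

lemma lintegral_enorm_fourier_translate_mul (hg : ContDiff ℝ ∞ g) (hs : HasCompactSupport g)
    (hc : 0 < c) (ψ : 𝓢(R3, ℂ)) (q : R3) :
    ∫⁻ p, ‖𝓕 (fun x => (g (x - q) : ℂ) * ψ x) (c⁻¹ • p)‖ₑ ^ 2
      = ENNReal.ofReal (c ^ 3) * ∫⁻ x, ‖g (x - q)‖ₑ ^ 2 * ‖ψ x‖ₑ ^ 2 := by
  have hFs : HasCompactSupport fun x => (g (x - q) : ℂ) * ψ x :=
    (hasCompactSupport_translate hs q).mul_right
  have hFd : ContDiff ℝ ∞ fun x => (g (x - q) : ℂ) * ψ x :=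
    (contDiff_translate hg q).mul ψ.smooth'
  have hP := lintegral_enorm_fourier_schwartz_sq (hFs.toSchwartzMap hFd)
  have hm : Measurable fun k => ‖𝓕 (fun x => (g (x - q) : ℂ) * ψ x) k‖ₑ ^ 2 := by
    have := (𝓕 (hFs.toSchwartzMap hFd)).continuous
    rw [SchwartzMap.fourier_coe] at this
    exact this.measurable.enorm.pow_const 2
  rw [lintegral_comp_inv_smul _ hm hc]
  congr 1
  refine hP.trans (lintegral_congr fun x => ?_)
  rw [HasCompactSupport.toSchwartzMap_toFun, enorm_mul, mul_pow, ← ofReal_norm (g (x - q) : ℂ),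
    Complex.norm_real, ofReal_norm]

/-- Plancherel in `p` leaves `|g(x - q)|² |ψ(x)|²`, and integration over `q` separates the factors.
The constant `c³` is the Jacobian of `p ↦ c⁻¹ p`. -/
lemma lintegral_enorm_inner_coherentState_toLp (hc : 0 < c) (ψ : 𝓢(R3, ℂ)) :
    ∫⁻ z, ‖⟪coherentState c hg hs z, ψ.toLp 2⟫_ℂ‖ₑ ^ 2
      = ENNReal.ofReal (c ^ 3) * ((∫⁻ x, ‖g x‖ₑ ^ 2) * ‖ψ.toLp 2‖ₑ ^ 2) := by
  have hgm := hg.continuous.measurable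
  have hψm := ψ.continuous.measurable
  have hgc : Measurable fun p : R3 × R3 => ‖g (p.2 - p.1)‖ₑ ^ 2 * ‖ψ p.2‖ₑ ^ 2 := by
    fun_prop
  rw [Measure.volume_eq_prod, lintegral_prod _
    ((measurable_inner_coherentState hg hs _).measurable.enorm.pow_const 2).aemeasurable]
  simp only [inner_coherentState_toLp, lintegral_enorm_fourier_translate_mul hg hs hc]
  rw [lintegral_const_mul _ hgc.lintegral_prod_right',
    lintegral_lintegral_swap hgc.aemeasurable]
  congr 1
  rw [enorm_sq_eq_lintegral,
    ← lintegral_const_mul _ ((Lp.stronglyMeasurable _).measurable.enorm.pow_const 2)]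
  refine lintegral_congr_ae ?_
  filter_upwards [ψ.coeFn_toLp 2] with x hx
  rw [hx, lintegral_mul_const _ (by fun_prop), lintegral_sub_left_eq_self (fun y => ‖g y‖ₑ ^ 2)]

/-- Density of Schwartz functions together with Fatou's lemma; the Bessel bound needs only the
inequality. -/
lemma lintegral_enorm_inner_coherentState_le (hc : 0 < c) (u : L2R3) :
    ∫⁻ z, ‖⟪coherentState c hg hs z, u⟫_ℂ‖ₑ ^ 2
      ≤ ENNReal.ofReal (c ^ 3) * ((∫⁻ x, ‖g x‖ₑ ^ 2) * ‖u‖ₑ ^ 2) := by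
  have hd : DenseRange (SchwartzMap.toLpCLM ℂ (E := R3) ℂ 2 volume) :=
    SchwartzMap.denseRange_toLpCLM (by norm_num)
  obtain ⟨v, hv, hlim⟩ := mem_closure_iff_seq_limit.1 (hd u)
  choose ψ hψ using hv
  have hle : ∀ n, ∫⁻ z, ‖⟪coherentState c hg hs z, v n⟫_ℂ‖ₑ ^ 2
      = ENNReal.ofReal (c ^ 3) * ((∫⁻ x, ‖g x‖ₑ ^ 2) * ‖v n‖ₑ ^ 2) := by
    intro n
    rw [← hψ n]
    exact lintegral_enorm_inner_coherentState_toLp hg hs hc (ψ n)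
  have hg2 : ∫⁻ x, ‖g x‖ₑ ^ 2 ≠ ⊤ := by
    rw [← enorm_coherentState_sq (c := c) hg hs 0]
    finiteness
  have hR : Tendsto (fun n => ENNReal.ofReal (c ^ 3) * ((∫⁻ x, ‖g x‖ₑ ^ 2) * ‖v n‖ₑ ^ 2)) atTop
      (𝓝 (ENNReal.ofReal (c ^ 3) * ((∫⁻ x, ‖g x‖ₑ ^ 2) * ‖u‖ₑ ^ 2))) := by
    refine ENNReal.Tendsto.const_mul (ENNReal.Tendsto.const_mul ?_ (Or.inr hg2))
      (Or.inr ENNReal.ofReal_ne_top)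
    exact ((ENNReal.continuous_pow 2).comp continuous_enorm).continuousAt.tendsto.comp hlim
  have hL : ∀ z, Tendsto (fun n => ‖⟪coherentState c hg hs z, v n⟫_ℂ‖ₑ ^ 2) atTop
      (𝓝 (‖⟪coherentState c hg hs z, u⟫_ℂ‖ₑ ^ 2)) := fun z =>
    ((ENNReal.continuous_pow 2).comp
      (continuous_enorm.comp (continuous_const.inner continuous_id))).continuousAt.tendsto.comp hlim
  calc ∫⁻ z, ‖⟪coherentState c hg hs z, u⟫_ℂ‖ₑ ^ 2
      = ∫⁻ z, liminf (fun n => ‖⟪coherentState c hg hs z, v n⟫_ℂ‖ₑ ^ 2) atTop :=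
        lintegral_congr fun z => (hL z).liminf_eq.symm
    _ ≤ liminf (fun n => ∫⁻ z, ‖⟪coherentState c hg hs z, v n⟫_ℂ‖ₑ ^ 2) atTop :=
        lintegral_liminf_le fun n =>
          (measurable_inner_coherentState hg hs _).measurable.enorm.pow_const 2
    _ = _ := by
        simp only [hle]
        exact hR.liminf_eq

end CoherentStates

end Chandrasekhar

namespace Chandrasekhar

open Filter Topology SchwartzMap
open scoped InnerProduct

/-! ### Semiclassical quantization of a phase space distribution. -/

section SemiclassicalOperator

lemma enorm_adjoint_comp_self_le {H K : Type*} [NormedAddCommGroup H] [InnerProductSpace ℂ H]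
    [NormedAddCommGroup K] [InnerProductSpace ℂ K] [CompleteSpace H] [CompleteSpace K]
    {V : H →L[ℂ] K} {C : ℝ≥0∞} (h : ∀ u, ‖V u‖ₑ ^ 2 ≤ C * ‖u‖ₑ ^ 2) :
    ‖V† ∘L V‖ₑ ≤ C := by
  by_cases hC : C = ⊤
  · simp [hC]
  have h1 : ‖V‖ ≤ √C.toReal := by
    refine V.opNorm_le_bound (Real.sqrt_nonneg _) fun u => ?_
    have h := ENNReal.toReal_mono (by finiteness) (h u)
    rw [ENNReal.toReal_mul, ENNReal.toReal_pow, ENNReal.toReal_pow, toReal_enorm,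
      toReal_enorm] at h
    refine abs_le_of_sq_le_sq' ?_ (by positivity) |>.2
    rwa [mul_pow, Real.sq_sqrt ENNReal.toReal_nonneg]
  rw [← ofReal_norm, ContinuousLinearMap.norm_adjoint_comp_self]
  refine ENNReal.ofReal_le_of_le_toReal ?_
  rw [← Real.mul_self_sqrt (ENNReal.toReal_nonneg (a := C))]
  gcongr

variable {g : R3 → ℝ}

lemma lintegral_enorm_fourier_profile_sq (hg : ContDiff ℝ ∞ g) (hs : HasCompactSupport g) :
    ∫⁻ ξ, ‖𝓕 (fun x => (g x : ℂ)) ξ‖ₑ ^ 2 = ∫⁻ x, ‖g x‖ₑ ^ 2 := by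
  have h1 : HasCompactSupport fun x => (g x : ℂ) := by
    simpa using hasCompactSupport_translate hs 0
  have h2 : ContDiff ℝ ∞ fun x => (g x : ℂ) := by simpa using contDiff_translate hg 0
  refine (lintegral_enorm_fourier_schwartz_sq (h1.toSchwartzMap h2)).trans
    (lintegral_congr fun x => ?_)
  rw [HasCompactSupport.toSchwartzMap_toFun, ← ofReal_norm (g x : ℂ), Complex.norm_real,
    ofReal_norm]

lemma continuous_fourier_profile (hg : ContDiff ℝ ∞ g) (hs : HasCompactSupport g) :
    Continuous (𝓕 fun x => (g x : ℂ)) := by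
  have h1 : HasCompactSupport fun x => (g x : ℂ) := by
    simpa using hasCompactSupport_translate hs 0
  have h2 : ContDiff ℝ ∞ fun x => (g x : ℂ) := by simpa using contDiff_translate hg 0
  have := (𝓕 (h1.toSchwartzMap h2)).continuous
  rw [SchwartzMap.fourier_coe] at this
  exact this

/-- The kinetic energy of the profile of a coherent state. -/
noncomputable def profileMomentum (g : R3 → ℝ) : ℝ≥0∞ :=
  ∫⁻ ξ, ‖(2 * Real.pi) • ξ‖ₑ * ‖𝓕 (fun x => (g x : ℂ)) ξ‖ₑ ^ 2

lemma profileMomentum_ne_top (hg : ContDiff ℝ ∞ g) (hs : HasCompactSupport g) :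
    profileMomentum g ≠ ⊤ := by
  have h1 : HasCompactSupport fun x => (g x : ℂ) := by
    simpa using hasCompactSupport_translate hs 0
  have h2 : ContDiff ℝ ∞ fun x => (g x : ℂ) := by simpa using contDiff_translate hg 0
  set F := 𝓕 (h1.toSchwartzMap h2) with hF
  have hFc : ⇑F = 𝓕 fun x => (g x : ℂ) := SchwartzMap.fourier_coe _
  obtain ⟨M, hM0, hM⟩ := F.decay 0 0
  simp only [pow_zero, norm_iteratedFDeriv_zero, one_mul] at hM
  have hint : Integrable fun ξ => ‖(2 * Real.pi) • ξ‖ * ‖F ξ‖ ^ 2 := by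
    refine ((F.integrable_pow_mul volume 1).const_mul (2 * Real.pi * M)).mono'
      (by have := F.continuous; fun_prop) (Eventually.of_forall fun ξ => ?_)
    rw [Real.norm_of_nonneg (by positivity), norm_smul, Real.norm_of_nonneg (by positivity), pow_one]
    calc 2 * Real.pi * ‖ξ‖ * ‖F ξ‖ ^ 2 = 2 * Real.pi * ‖ξ‖ * ‖F ξ‖ * ‖F ξ‖ := by ring
      _ ≤ 2 * Real.pi * ‖ξ‖ * ‖F ξ‖ * M := by gcongr; exact hM ξ
      _ = _ := by ring
  have := hint.hasFiniteIntegral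
  rw [hasFiniteIntegral_iff_enorm] at this
  refine ne_of_lt (lt_of_eq_of_lt (lintegral_congr fun ξ => ?_) this)
  rw [enorm_mul, enorm_pow, enorm_norm, enorm_norm, hFc]

/-- After translation by `k`, the triangle inequality splits the frequency into `2πk = p/ħ` and the
profile's own frequency, weighted by a density of total mass one. The affine hypothesis on `m`
covers both the Bessel symbol (`A = B = 1`) and the kinetic symbol (`A = 0`, `B = ħ`). -/
lemma lintegral_multiplier_fourier_profile_le (hg : ContDiff ℝ ∞ g) (hs : HasCompactSupport g)
    (hg1 : ∫⁻ x, ‖g x‖ₑ ^ 2 = 1) {m : R3 → ℝ} {A B : ℝ≥0∞}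
    (hm : ∀ ζ, ‖m ζ‖ₑ ^ 2 ≤ A + B * ‖ζ‖ₑ) {ħ : ℝ} (hħ : 0 < ħ) (p : R3) :
    ∫⁻ ξ, ‖m ((2 * Real.pi) • ξ)‖ₑ ^ 2 *
        ‖𝓕 (fun x => (g x : ℂ)) (ξ - (2 * Real.pi * ħ)⁻¹ • p)‖ₑ ^ 2
      ≤ A + B * ((ENNReal.ofReal ħ)⁻¹ * ‖p‖ₑ) + B * profileMomentum g := by
  set G := 𝓕 (fun x => (g x : ℂ)) with hG
  have hGc : Continuous G := continuous_fourier_profile hg hs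
  have hG2 : Measurable fun ξ => ‖G ξ‖ₑ ^ 2 := hGc.measurable.enorm.pow_const 2
  have hG1 : ∫⁻ ξ, ‖G ξ‖ₑ ^ 2 = 1 := (lintegral_enorm_fourier_profile_sq hg hs).trans hg1
  set k := (2 * Real.pi * ħ)⁻¹ • p with hk
  have hkp : ‖(2 * Real.pi) • k‖ₑ = (ENNReal.ofReal ħ)⁻¹ * ‖p‖ₑ := by
    rw [hk, smul_smul, enorm_smul, mul_inv, mul_inv_cancel_left₀ (by positivity),
      Real.enorm_of_nonneg (by positivity), ENNReal.ofReal_inv_of_pos hħ]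
  rw [← lintegral_add_right_eq_self _ k]
  calc ∫⁻ ξ, ‖m ((2 * Real.pi) • (ξ + k))‖ₑ ^ 2 * ‖G (ξ + k - k)‖ₑ ^ 2
      ≤ ∫⁻ ξ, ((A + B * ((ENNReal.ofReal ħ)⁻¹ * ‖p‖ₑ)) * ‖G ξ‖ₑ ^ 2
          + B * (‖(2 * Real.pi) • ξ‖ₑ * ‖G ξ‖ₑ ^ 2)) := by
        refine lintegral_mono fun ξ => ?_
        rw [add_sub_cancel_right, ← mul_assoc B ‖_‖ₑ, ← add_mul]
        gcongr
        refine (hm _).trans ?_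
        rw [add_assoc, ← mul_add, ← hkp, smul_add, add_comm ‖(2 * Real.pi) • k‖ₑ]
        gcongr
        exact enorm_add_le _ _
    _ = _ := by
        have h3 : Measurable fun ξ => ‖(2 * Real.pi) • ξ‖ₑ * ‖G ξ‖ₑ ^ 2 :=
          (measurable_const_smul (2 * Real.pi)).enorm.mul hG2
        rw [lintegral_add_left (hG2.const_mul _), lintegral_const_mul _ hG2, hG1, mul_one,
          lintegral_const_mul _ h3, profileMomentum]

lemma enorm_rpow_half_sq {t : ℝ} (ht : 0 ≤ t) : ‖t ^ (1 / 2 : ℝ)‖ₑ ^ 2 = ENNReal.ofReal t := by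
  rw [Real.enorm_of_nonneg (by positivity), ← ENNReal.ofReal_pow (by positivity),
    ← Real.sqrt_eq_rpow, Real.sq_sqrt ht]

lemma enorm_bessel_symbol_sq_le (ζ : R3) :
    ‖(1 + ‖ζ‖ ^ 2) ^ (1 / 4 : ℝ)‖ₑ ^ 2 ≤ 1 + 1 * ‖ζ‖ₑ := by
  have h : ((1 + ‖ζ‖ ^ 2) ^ (1 / 4 : ℝ)) = (√(1 + ‖ζ‖ ^ 2)) ^ (1 / 2 : ℝ) := by
    rw [Real.sqrt_eq_rpow, ← Real.rpow_mul (by positivity)]; norm_num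
  rw [h, enorm_rpow_half_sq (Real.sqrt_nonneg _), one_mul, ← ofReal_norm, ← ENNReal.ofReal_one,
    ← ENNReal.ofReal_add zero_le_one (norm_nonneg _)]
  refine ENNReal.ofReal_le_ofReal (Real.sqrt_le_iff.2 ⟨by positivity, ?_⟩)
  nlinarith [norm_nonneg ζ]

lemma integrable_mul_sq_comp_sub {f : R3 × R3 → ℝ} (hf : Integrable f) (hg : Continuous g)
    (hs : HasCompactSupport g) (x : R3) :
    Integrable fun z : R3 × R3 => f z * g (x - z.1) ^ 2 := by
  obtain ⟨M, hM⟩ := hg.bounded_above_of_compact_support hs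
  refine hf.mul_bdd (c := M ^ 2) (by fun_prop) (Eventually.of_forall fun z => ?_)
  rw [norm_pow]
  have := hM (x - z.1)
  gcongr

/-- The semiclassical quantization of a phase space distribution by coherent states. -/
theorem exists_semiclassical_operator {f : R3 × R3 → ℝ} (hf : IsClassicalAdmissible f)
    (hg : ContDiff ℝ ∞ g) (hs : HasCompactSupport g) (hg1 : ∫⁻ x, ‖g x‖ₑ ^ 2 = 1)
    {ħ : ℝ} (hħ : 0 < ħ) :
    ∃ γ : L2R3 →L[ℂ] L2R3, IsQuantumAdmissible γ ∧ ‖γ‖ₑ ≤ eLpNorm f ⊤ volume ∧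
      scTrace ħ γ = eLpNorm f 1 volume ∧
      scKinetic ħ γ ≤ eLpNorm (fun z => ‖z.2‖ * f z) 1 volume
        + ENNReal.ofReal ħ * profileMomentum g * eLpNorm f 1 volume ∧
      scDensity ħ γ =ᵐ[volume] fun x => ∫ q, kineticDensity f q * g (x - q) ^ 2 := by
  set c : ℝ := 2 * Real.pi * ħ with hcdef
  have hc : 0 < c := by positivity
  set a : ℝ≥0∞ := ENNReal.ofReal (c ^ 3) with ha
  have ha0 : a ≠ 0 := by rw [ha]; simp; positivity
  have hat : a ≠ ⊤ := ENNReal.ofReal_ne_top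
  have hfm : AEMeasurable (fun z => ‖f z‖ₑ) volume := hf.integrable.aestronglyMeasurable.enorm
  have hf1 : ∫⁻ z, ‖f z‖ₑ ≠ ⊤ := hf.integrable.2.ne
  have hpf : ∫⁻ z, ‖f z‖ₑ * ‖z.2‖ₑ ≠ ⊤ := by
    have := hf.integrable_momentum.2
    rw [hasFiniteIntegral_iff_enorm] at this
    refine ne_of_lt (lt_of_eq_of_lt (lintegral_congr fun z => ?_) this)
    rw [enorm_mul, enorm_norm, mul_comm]
  -- The weight `a⁻¹ = (2πħ)⁻³` cancels the factor in the semiclassical trace; `|f|` agrees with `f`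
  -- almost everywhere.
  let μ : Measure (R3 × R3) := a⁻¹ • (volume.withDensity fun z => ‖f z‖ₑ)
  have hμ : ∀ F : R3 × R3 → ℝ≥0∞, Measurable F → a * ∫⁻ z, F z ∂μ = ∫⁻ z, ‖f z‖ₑ * F z := by
    intro F hF
    rw [lintegral_smul_measure, lintegral_withDensity_eq_lintegral_mul₀ hfm hF.aemeasurable,
      smul_eq_mul, ← mul_assoc, ENNReal.mul_inv_cancel ha0 hat, one_mul]
    rfl
  have hφ : ∀ u, StronglyMeasurable fun z => ⟪coherentState c hg hs z, u⟫_ℂ :=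
    measurable_inner_coherentState hg hs
  have hfinf : eLpNorm f ⊤ volume ≤ 1 := by
    rw [eLpNorm_exponent_top]
    refine eLpNormEssSup_le_of_ae_enorm_bound (hf.mem_Icc.mono fun z hz => ?_)
    rw [Real.enorm_of_nonneg hz.1]
    exact ENNReal.ofReal_le_one.2 hz.2
  -- The Bessel constant `‖f‖_∞ ≤ 1` bounds `‖γ‖` in the quotient and also gives `γ ≤ 1`.
  have hbessel : ∀ u, ∫⁻ z, ‖⟪coherentState c hg hs z, u⟫_ℂ‖ₑ ^ 2 ∂μ
      ≤ eLpNorm f ⊤ volume * ‖u‖ₑ ^ 2 := by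
    intro u
    refine (ENNReal.mul_le_mul_iff_right ha0 hat).1 ?_
    rw [hμ _ ((hφ u).measurable.enorm.pow_const 2)]
    calc ∫⁻ z, ‖f z‖ₑ * ‖⟪coherentState c hg hs z, u⟫_ℂ‖ₑ ^ 2
        ≤ ∫⁻ z, eLpNorm f ⊤ volume * ‖⟪coherentState c hg hs z, u⟫_ℂ‖ₑ ^ 2 := by
          refine lintegral_mono_ae ?_
          filter_upwards [ae_le_eLpNormEssSup (f := f) (μ := volume)] with z hz
          rw [eLpNorm_exponent_top]
          gcongr
      _ ≤ eLpNorm f ⊤ volume * (a * (1 * ‖u‖ₑ ^ 2)) := by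
          rw [lintegral_const_mul _ ((hφ u).measurable.enorm.pow_const 2), ← hg1]
          gcongr
          exact lintegral_enorm_inner_coherentState_le hg hs hc u
      _ = _ := by ring
  obtain ⟨V, hV⟩ := exists_analysisOperator (fun u => (hφ u).aestronglyMeasurable)
    (ne_top_of_le_ne_top ENNReal.one_ne_top hfinf) hbessel
  have hφ' := fun u => (hφ u).aestronglyMeasurable (μ := μ)
  have hnorm := enorm_adjoint_comp_self_le fun u => (hV u).trans_le (hbessel u)
  have htrace : trace (V† ∘L V) = μ Set.univ := by
    rw [trace_frameOperator hφ' hV]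
    simp only [enorm_coherentState_sq, hg1, lintegral_one]
  have hμuniv : a * μ Set.univ = ∫⁻ z, ‖f z‖ₑ := by
    rw [← lintegral_one, hμ _ measurable_const]
    simp only [mul_one]
  have hμfin : μ Set.univ ≠ ⊤ := fun h => hf1 (by rw [← hμuniv, h, ENNReal.mul_top ha0])
  have hmult : ∀ {m : R3 → ℝ} {A B : ℝ≥0∞}, Measurable m → (∀ ζ, ‖m ζ‖ₑ ^ 2 ≤ A + B * ‖ζ‖ₑ) →
      a * multiplierTrace m (V† ∘L V) ≤ A * (∫⁻ z, ‖f z‖ₑ)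
        + B * (ENNReal.ofReal ħ)⁻¹ * (∫⁻ z, ‖f z‖ₑ * ‖z.2‖ₑ)
        + B * profileMomentum g * ∫⁻ z, ‖f z‖ₑ := by
    intro m A B hm hmle
    have hGc := continuous_fourier_profile hg hs
    rw [multiplierTrace_frameOperator hφ' hV (h := fun z ξ =>
        ‖𝓕 (fun x => (g x : ℂ)) (ξ - c⁻¹ • z.2)‖ₑ ^ 2)
      (Continuous.measurable (by fun_prop)) (enorm_fourier_coherentState hg hs) hm]
    calc a * ∫⁻ z, ∫⁻ ξ, ‖m ((2 * Real.pi) • ξ)‖ₑ ^ 2 *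
            ‖𝓕 (fun x => (g x : ℂ)) (ξ - c⁻¹ • z.2)‖ₑ ^ 2 ∂volume ∂μ
        ≤ a * ∫⁻ z, (A + B * ((ENNReal.ofReal ħ)⁻¹ * ‖z.2‖ₑ) + B * profileMomentum g) ∂μ := by
          gcongr with z
          exact lintegral_multiplier_fourier_profile_le hg hs hg1 hmle hħ z.2
      _ = ∫⁻ z, (A * ‖f z‖ₑ + B * (ENNReal.ofReal ħ)⁻¹ * (‖f z‖ₑ * ‖z.2‖ₑ)
            + B * profileMomentum g * ‖f z‖ₑ) := by
          rw [hμ _ (by fun_prop)]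
          refine lintegral_congr fun z => ?_
          ring
      _ = _ := by
          have h2 : AEMeasurable (fun z : R3 × R3 => ‖f z‖ₑ * ‖z.2‖ₑ) volume :=
            hfm.mul (by fun_prop)
          rw [lintegral_add_right' _ (hfm.const_mul _), lintegral_add_right' _ (h2.const_mul _),
            lintegral_const_mul'' _ hfm, lintegral_const_mul'' _ h2, lintegral_const_mul'' _ hfm]
  have hnn : 0 ≤ V† ∘L V := by
    rw [ContinuousLinearMap.nonneg_iff_isPositive]
    exact ContinuousLinearMap.isPositive_adjoint_comp_self V
  refine ⟨V† ∘L V, ⟨?_, ?_, hnn, ?_, ?_⟩, hnorm, ?_, ?_, ?_⟩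
  -- Finite trace of `V† V` means that `V` is Hilbert-Schmidt.
  · refine (isCompactOperator_of_tsum_lt_top onb V ?_).clm_comp (V†)
    have : ∑' i, ‖V (onb i)‖ₑ ^ 2 = trace (V† ∘L V) := by
      refine tsum_congr fun i => ?_
      rw [← ContinuousLinearMap.apply_norm_sq_eq_inner_adjoint_right,
        ENNReal.ofReal_pow (norm_nonneg _), ofReal_norm]
    rw [this, htrace]
    exact hμfin
  · exact IsSelfAdjoint.of_nonneg hnn
  · refine (CStarAlgebra.norm_le_one_iff_of_nonneg _ hnn).1 ?_
    have := hnorm.trans hfinf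
    rw [← ofReal_norm] at this
    exact ENNReal.ofReal_le_one.1 this
  · have h := hmult (m := fun ξ => (1 + ‖ξ‖ ^ 2) ^ (1 / 4 : ℝ)) (by fun_prop)
      enorm_bessel_symbol_sq_le
    have hP := profileMomentum_ne_top hg hs
    have hħ' : (ENNReal.ofReal ħ)⁻¹ ≠ ⊤ := by simpa using hħ
    have hfin := h.trans_lt (show _ < ⊤ by finiteness)
    exact lt_top_iff_ne_top.2 fun htop => hfin.ne (by rw [htop, ENNReal.mul_top ha0])
  · rw [scTrace, htrace, eLpNorm_one_eq_lintegral_enorm, ← hμuniv]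
  -- With `B = ħ` the factor `ħ⁻¹` in front of the momentum term cancels, while the profile's
  -- contribution keeps a factor `ħ`.
  · have h := hmult (m := fun ξ => (ħ * ‖ξ‖) ^ (1 / 2 : ℝ)) (A := 0) (B := ENNReal.ofReal ħ)
      (by fun_prop) fun ζ => by
        rw [enorm_rpow_half_sq (by positivity), ENNReal.ofReal_mul hħ.le, ofReal_norm, zero_add]
    rw [zero_mul, zero_add, ENNReal.mul_inv_cancel (by simpa using hħ) ENNReal.ofReal_ne_top,
      one_mul] at h
    rw [scKinetic, eLpNorm_one_eq_lintegral_enorm, eLpNorm_one_eq_lintegral_enorm]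
    refine h.trans_eq ?_
    congr 1
    refine lintegral_congr fun z => ?_
    rw [enorm_mul, enorm_norm, mul_comm]
  · have hgc := hg.continuous
    have hd := tsum_enorm_opSqrt_sq_ae_eq hφ' hV (LinearIsometryEquiv.refl ℂ L2R3)
      (h := fun z x => ‖g (x - z.1)‖ₑ ^ 2) (Continuous.measurable (by fun_prop)) fun z => by
        filter_upwards [coeFn_coherentState (c := c) hg hs z] with x hx
        rw [← enorm_wavePacket (c := c), ← hx]
        rfl
    filter_upwards [hd] with x hx
    have hx' : ∑' i, ‖(opSqrt (V† ∘L V) (onb i) : L2R3) x‖ₑ ^ 2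
      = ∫⁻ z, ‖g (x - z.1)‖ₑ ^ 2 ∂μ := hx
    have hint := integrable_mul_sq_comp_sub hf.integrable hgc hs x
    rw [scDensity, density, hx', ← hcdef]
    calc c ^ 3 * (∫⁻ z, ‖g (x - z.1)‖ₑ ^ 2 ∂μ).toReal
        = (∫⁻ z, ‖f z‖ₑ * ‖g (x - z.1)‖ₑ ^ 2).toReal := by
          rw [← hμ _ (Continuous.measurable (by fun_prop)), ENNReal.toReal_mul, ha,
            ENNReal.toReal_ofReal (by positivity)]
      _ = ∫ z, ‖f z * g (x - z.1) ^ 2‖ := by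
          rw [integral_norm_eq_lintegral_enorm hint.aestronglyMeasurable]
          simp only [enorm_mul, enorm_pow]
      _ = ∫ z, f z * g (x - z.1) ^ 2 := by
          refine integral_congr_ae (hf.mem_Icc.mono fun z hz => ?_)
          exact Real.norm_of_nonneg (mul_nonneg hz.1 (sq_nonneg _))
      _ = ∫ q, kineticDensity f q * g (x - q) ^ 2 := by
          rw [Measure.volume_eq_prod, integral_prod _ hint]
          simp only [integral_mul_const, kineticDensity]

end SemiclassicalOperator

end Chandrasekhar

namespace Chandrasekhar

open Filter Topology

/-! ### Independence of `ħ` and the two limits. -/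

section CriticalMass

lemma multiplierTrace_scaled_sqrt {ħ : ℝ} (hħ : 0 < ħ) (γ : L2R3 →L[ℂ] L2R3) :
    multiplierTrace (fun ξ => (ħ * ‖ξ‖) ^ (1 / 2 : ℝ)) γ
      = ENNReal.ofReal ħ * multiplierTrace (fun ξ => ‖ξ‖ ^ (1 / 2 : ℝ)) γ := by
  simp only [multiplierTrace, multiplierNormSq, ← ENNReal.tsum_mul_left]
  refine tsum_congr fun i => ?_
  rw [← lintegral_const_mul' _ _ ENNReal.ofReal_ne_top]
  refine lintegral_congr fun ξ => ?_
  rw [enorm_rpow_half_sq (by positivity), enorm_rpow_half_sq (by positivity),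
    ENNReal.ofReal_mul hħ.le, mul_assoc]

/-- Power counting in `b = 2πħ`: the numerator scales as `b² · b³ · b`, the energy as `(b³)²`, and
both powers are `b⁶`. -/
lemma quantumQuotient_eq {ħ : ℝ} (hħ : 0 < ħ) (γ : L2R3 →L[ℂ] L2R3) :
    quantumQuotient ħ γ = ‖γ‖ₑ ^ (1 / 3 : ℝ) * trace γ ^ (2 / 3 : ℝ) *
      (ENNReal.ofReal (1 / (2 * Real.pi)) * multiplierTrace (fun ξ => ‖ξ‖ ^ (1 / 2 : ℝ)) γ) /
        fieldEnergy (density γ) := by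
  set b := ENNReal.ofReal (2 * Real.pi * ħ) with hb
  have hb0 : b ≠ 0 := by rw [hb]; simp; positivity
  have hbt : b ≠ ⊤ := ENNReal.ofReal_ne_top
  have ha : ENNReal.ofReal ((2 * Real.pi * ħ) ^ 3) = b ^ 3 := ENNReal.ofReal_pow (by positivity) 3
  have hh : ENNReal.ofReal ħ = b * ENNReal.ofReal (1 / (2 * Real.pi)) := by
    rw [hb, ← ENNReal.ofReal_mul (by positivity)]
    congr 1
    field_simp
  have hE : fieldEnergy (scDensity ħ γ) = (b ^ 3) ^ 2 * fieldEnergy (density γ) := by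
    rw [← ha]
    exact fieldEnergy_const_mul (density γ) (by positivity)
  have hp : (b ^ 3) ^ (2 / 3 : ℝ) = b ^ 2 := by
    rw [← ENNReal.rpow_natCast, ← ENNReal.rpow_mul, ← ENNReal.rpow_natCast]
    norm_num
  rw [quantumQuotient, scTrace, scKinetic, multiplierTrace_scaled_sqrt hħ, hE, ha, hh,
    ENNReal.mul_rpow_of_nonneg _ _ (by norm_num), hp,
    ← ENNReal.mul_div_mul_left (c := (b ^ 3) ^ 2) (‖γ‖ₑ ^ (1 / 3 : ℝ) * _ * _)
      (fieldEnergy (density γ)) (by positivity) (by finiteness)]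
  congr 1
  ring

/-- The quantum sharp constant does not depend on `ħ`. -/
lemma quantumConstant_eq {ħ ħ' : ℝ} (hħ : 0 < ħ) (hħ' : 0 < ħ') :
    quantumConstant ħ = quantumConstant ħ' := by
  simp only [quantumConstant, quantumQuotient_eq hħ, quantumQuotient_eq hħ']

lemma hasCompactSupport_sq {g : R3 → ℝ} (hs : HasCompactSupport g) :
    HasCompactSupport fun x => g x ^ 2 :=
  hs.comp_left (g := fun t : ℝ => t ^ 2) (by norm_num)

/-- Smooth normalized profiles concentrating at the origin. -/
lemma exists_profile (r : ℝ) (hr : 0 < r) :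
    ∃ g : R3 → ℝ, ContDiff ℝ ∞ g ∧ HasCompactSupport g ∧ (∀ x, g (-x) = g x) ∧
      ∫ x, g x ^ 2 = 1 ∧ Function.support g ⊆ Metric.ball 0 r := by
  let b : ContDiffBump (0 : R3) := ⟨r / 2, r, by positivity, by linarith⟩
  have hbs : HasCompactSupport fun x => b x ^ 2 := hasCompactSupport_sq b.hasCompactSupport
  have hI : 0 < ∫ x, b x ^ 2 := by
    refine Continuous.integral_pos_of_hasCompactSupport_nonneg_nonzero (x := 0)
      (by have := b.continuous; fun_prop) hbs (fun x => sq_nonneg _) ?_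
    rw [b.one_of_mem_closedBall (by simp [b.rIn_pos.le])]
    norm_num
  refine ⟨fun x => b x / √(∫ x, b x ^ 2), b.contDiff.div_const _, ?_, fun x => ?_, ?_, ?_⟩
  · simp only [div_eq_mul_inv]
    exact b.hasCompactSupport.mul_right
  · simp only [b.neg]
  · simp only [div_pow, Real.sq_sqrt hI.le]
    rw [integral_div, div_self hI.ne']
  · refine (Function.support_subset_iff'.2 fun x hx => ?_)
    have : b x = 0 := b.zero_of_le_dist (by simpa using hx)
    simp [this]

lemma IsClassicalAdmissible.integrable_kineticDensity {f : R3 × R3 → ℝ}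
    (hf : IsClassicalAdmissible f) : Integrable (kineticDensity f) :=
  hf.integrable.integral_prod_left

lemma ae_snd_ne_zero : ∀ᵐ z : R3 × R3, z.2 ≠ 0 := by
  have h : ∀ᵐ p : R3, p ≠ 0 := compl_mem_ae_iff.2 (measure_singleton 0)
  exact (Measure.quasiMeasurePreserving_snd (μ := (volume : Measure R3))
    (ν := (volume : Measure R3))).ae h

/-- The numerator of the classical quotient. -/
noncomputable def classicalNumerator (f : R3 × R3 → ℝ) : ℝ≥0∞ :=
  eLpNorm f ⊤ volume ^ (1 / 3 : ℝ) * eLpNorm f 1 volume ^ (2 / 3 : ℝ) *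
    eLpNorm (fun z => ‖z.2‖ * f z) 1 volume

lemma eLpNorm_top_ne_top {f : R3 × R3 → ℝ} (hf : IsClassicalAdmissible f) :
    eLpNorm f ⊤ volume ≠ ⊤ := by
  rw [eLpNorm_exponent_top]
  refine ne_top_of_le_ne_top ENNReal.one_ne_top
    (eLpNormEssSup_le_of_ae_enorm_bound (hf.mem_Icc.mono fun z hz => ?_))
  rw [Real.enorm_of_nonneg hz.1]
  exact ENNReal.ofReal_le_one.2 hz.2

lemma classicalNumerator_ne_top {f : R3 × R3 → ℝ} (hf : IsClassicalAdmissible f) :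
    classicalNumerator f ≠ ⊤ := by
  have h0 := eLpNorm_top_ne_top hf
  have h1 := (memLp_one_iff_integrable.2 hf.integrable).eLpNorm_ne_top
  have h2 := (memLp_one_iff_integrable.2 hf.integrable_momentum).eLpNorm_ne_top
  unfold classicalNumerator
  finiteness

/-- A nonzero finite numerator makes division in `ℝ≥0∞` reversible even when the denominator is `0`
or `∞`. -/
lemma classicalNumerator_ne_zero {f : R3 × R3 → ℝ} (hf : IsClassicalAdmissible f)
    (hf0 : ¬ f =ᵐ[volume] 0) : classicalNumerator f ≠ 0 := by
  have hm := hf.integrable.aestronglyMeasurable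
  have h0 : eLpNorm f ⊤ volume ≠ 0 := fun h => hf0 ((eLpNorm_eq_zero_iff hm (by simp)).1 h)
  have h1 : eLpNorm f 1 volume ≠ 0 := fun h => hf0 ((eLpNorm_eq_zero_iff hm (by simp)).1 h)
  have h2 : eLpNorm (fun z => ‖z.2‖ * f z) 1 volume ≠ 0 := by
    intro h
    rw [eLpNorm_eq_zero_iff hf.integrable_momentum.aestronglyMeasurable (by simp)] at h
    refine hf0 ?_
    filter_upwards [h, ae_snd_ne_zero] with z hz hz2
    simpa [hz2] using hz
  refine mul_ne_zero (mul_ne_zero ?_ ?_) h2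
  · simpa using h0
  · simp [h1]
    norm_num

/-- Semiclassical trial states bound the quantum constant by mollified classical quotients. -/
lemma quantumConstant_mul_fieldEnergy_mollified_le {ħ : ℝ} (hħ : 0 < ħ) {f : R3 × R3 → ℝ}
    (hf : IsClassicalAdmissible f) (hf0 : ¬ f =ᵐ[volume] 0) {g : R3 → ℝ}
    (hg : ContDiff ℝ ∞ g) (hs : HasCompactSupport g) (hg1 : ∫ x, g x ^ 2 = 1) :
    quantumConstant ħ * fieldEnergy (fun x => ∫ q, kineticDensity f q * g (x - q) ^ 2)
      ≤ classicalNumerator f := by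
  have hg1' : ∫⁻ x, ‖g x‖ₑ ^ 2 = 1 := by
    have hi : Integrable fun x => g x ^ 2 := by
      refine Continuous.integrable_of_hasCompactSupport (by have := hg.continuous; fun_prop) ?_
      exact hasCompactSupport_sq hs
    rw [← ENNReal.ofReal_one, ← hg1, ofReal_integral_eq_lintegral_ofReal hi
      (Eventually.of_forall fun x => sq_nonneg _)]
    refine lintegral_congr fun x => ?_
    rw [← enorm_pow, Real.enorm_of_nonneg (sq_nonneg _)]
  set E := fieldEnergy (fun x => ∫ q, kineticDensity f q * g (x - q) ^ 2) with hE
  set L := eLpNorm f 1 volume with hL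
  set P := eLpNorm (fun z => ‖z.2‖ * f z) 1 volume with hP
  set A := eLpNorm f ⊤ volume ^ (1 / 3 : ℝ) * L ^ (2 / 3 : ℝ) with hA
  have hLtop : L ≠ ⊤ := (memLp_one_iff_integrable.2 hf.integrable).eLpNorm_ne_top
  have hAtop : A ≠ ⊤ := by
    have := eLpNorm_top_ne_top hf
    rw [hA]
    finiteness
  have hD := profileMomentum_ne_top hg hs
  -- The trial state is built at Planck constant `t`, but the left side stays at `ħ` because the
  -- quantum constant is the same at both. This frees `t` to tend to `0`.
  have key : ∀ t : ℝ, 0 < t →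
      quantumConstant ħ * E ≤ A * (P + ENNReal.ofReal t * (profileMomentum g * L)) := by
    intro t ht
    obtain ⟨γ, hγ, hnorm, htr, hkin, hdens⟩ := exists_semiclassical_operator hf hg hs hg1' ht
    have hγ0 : γ ≠ 0 := by
      rintro rfl
      have : L = 0 := by rw [hL, ← htr]; simp [scTrace, trace]
      exact hf0 ((eLpNorm_eq_zero_iff hf.integrable.aestronglyMeasurable (by simp)).1 this)
    have hle : quantumConstant t ≤ quantumQuotient t γ :=
      iInf_le_of_le γ (iInf_le_of_le hγ (iInf_le _ hγ0))
    rw [quantumConstant_eq hħ ht]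
    refine ENNReal.mul_le_of_le_div (hle.trans ?_)
    rw [quantumQuotient, fieldEnergy_congr hdens, htr, ← mul_assoc (ENNReal.ofReal t)]
    rw [hA]
    gcongr
  have hlim : Tendsto (fun t : ℝ => A * (P + ENNReal.ofReal t * (profileMomentum g * L)))
      (𝓝[>] 0) (𝓝 (A * (P + ENNReal.ofReal 0 * (profileMomentum g * L)))) := by
    refine ENNReal.Tendsto.const_mul (Tendsto.const_add P ?_) (Or.inr hAtop)
    refine ENNReal.Tendsto.mul_const ?_ (Or.inr (by finiteness))
    exact (ENNReal.continuous_ofReal.tendsto 0).mono_left nhdsWithin_le_nhds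
  rw [ENNReal.ofReal_zero, zero_mul, add_zero] at hlim
  exact ge_of_tendsto hlim (eventually_nhdsWithin_of_forall key)

lemma quantumConstant_mul_fieldEnergy_le {ħ : ℝ} (hħ : 0 < ħ) {f : R3 × R3 → ℝ}
    (hf : IsClassicalAdmissible f) (hf0 : ¬ f =ᵐ[volume] 0) :
    quantumConstant ħ * fieldEnergy (kineticDensity f) ≤ classicalNumerator f := by
  have hN0 := classicalNumerator_ne_zero hf hf0
  have hNt := classicalNumerator_ne_top hf
  choose g hg hs heven hg1 hsupp using fun n : ℕ => exists_profile (1 / ((n : ℝ) + 1)) (by positivity)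
  -- Isolating the field energy allows passing to the limit in `g`; no information on whether the
  -- quantum constant is `0` or `∞` is needed.
  rw [mul_comm, ← ENNReal.le_div_iff_mul_le (Or.inr hN0) (Or.inr hNt)]
  refine fieldEnergy_le_of_mollification hf.integrable_kineticDensity (η := fun n x => g n x ^ 2)
    (fun n => (hg n).continuous.pow 2) (fun n => ?_) (fun n x => sq_nonneg _)
    (fun n x => by rw [heven]) hg1 ?_ fun n => ?_
  · exact hasCompactSupport_sq (hs n)
  · rw [tendsto_smallSets_iff]
    intro t ht
    obtain ⟨ε, hε, hεt⟩ := Metric.mem_nhds_iff.1 ht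
    filter_upwards [tendsto_one_div_add_atTop_nhds_zero_nat.eventually_lt_const hε] with n hn
    refine fun x hx => hεt (Metric.ball_subset_ball hn.le (hsupp n ?_))
    exact fun h => hx (by simp [h])
  · rw [ENNReal.le_div_iff_mul_le (Or.inr hN0) (Or.inr hNt), mul_comm]
    exact quantumConstant_mul_fieldEnergy_mollified_le hħ hf hf0 (hg n) (hs n) (hg1 n)

lemma quantumConstant_le_classicalConstant {ħ : ℝ} (hħ : 0 < ħ) :
    quantumConstant ħ ≤ classicalConstant := by
  refine le_iInf fun f => le_iInf fun hf => le_iInf fun hf0 => ?_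
  exact (ENNReal.le_div_iff_mul_le (Or.inr (classicalNumerator_ne_zero hf hf0))
    (Or.inr (classicalNumerator_ne_top hf))).2 (quantumConstant_mul_fieldEnergy_le hħ hf hf0)

end CriticalMass

end Chandrasekhar

theorem mainTheorem7 (ħ : ℝ) (hħ : 0 < ħ) :
    Chandrasekhar.quantumCriticalMass ħ ≤ Chandrasekhar.classicalCriticalMass := by
  unfold Chandrasekhar.quantumCriticalMass Chandrasekhar.classicalCriticalMass
  gcongr
  exact Chandrasekhar.quantumConstant_le_classicalConstant hħ
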